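/- **Sampling of determinantal linear processes (DLP).** *Setting.* Let $E$ be a finite-dimensional real Euclidean or complex Hermitian space. A *splitting* of $E$ is a finite family $\sigma=(E_i)_{i\in I}$ of pairwise orthogonal subspaces with $E=\bigoplus_i E_i$ (blocks equal to $0$ are allowed); write $d_i=\dim E_i$ and let $\mathrm U(E,\sigma)$ be the compact group of isometries $u$ of $E$ with $u(E_i)=E_i$ for all $i$, with normalised Haar measure $\mathrm du$. A splitting $\delta$ is *finer* than $\sigma$ if each block of $\delta$ is contained in a block of $\sigma$; $u(\delta)$ is the splitting whose blocks are the images under $u$ of those of $\delta$. Let $\mathsf{Gr}(E,\sigma)$ be the set of subspaces $Q$ of $E$ *adapted* to $\sigma$, that is, $Q=\bigoplus_i (Q\cap E_i)$, with the topology given by the orthogonal projections and its Borel $\sigma$-algebra; each such $Q$ carries the splitting $\sigma_Q=(Q\cap E_i)_i$. Let $\nu^{E,\sigma}$ be the $\mathrm U(E,\sigma)$-invariant Borel measure on $\mathsf{Gr}(E,\sigma)$ that gives mass $\prod_i\binom{d_i}{n_i}$ to $\{Q:\dim (Q\cap E_i)=n_i\ \forall i\}$ for every $(n_i)$ with $0\le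 n_i\le d_i$. A *kernel* on $E$ is a self-adjoint endomorphism $\mathsf k$ with $0\le \mathsf k\le 1$; for a subspace $Q$, $\mathsf k_Q^Q:Q\to Q$ is $\mathsf k$ restricted to $Q$ followed by the orthogonal projection onto $Q$. A Borel probability measure $\mu$ on $\mathsf{Gr}(E,\sigma)$ is a *determinantal linear process* on $(E,\sigma)$ with kernel $\mathsf k$ if its incidence measure $\int \nu^{Q,\sigma_Q}\,\mathrm d\mu(Q)$ (where $\nu^{Q,\sigma_Q}$ is seen as a measure on $\mathsf{Gr}(E,\sigma)$ through $\mathsf{Gr}(Q,\sigma_Q)\subseteq\mathsf{Gr}(E,\sigma)$) has density $Q\mapsto\det \mathsf k_Q^Q$ with respect to $\nu^{E,\sigma}$. For a matrix $K$ with rows and columns indexed by a finite set $S$, a random subset $X$ of $S$ is a *determinantal point process* (DPP) with kernel $K$ if $\mathbb P(J\subseteq X)=\det (K_{pq})_{p,q\in J}$ for every $J\subseteq S$. *Statement.* Let $\sigma$ be a splitting of $E$ and $\mathsf k$ a kernel on $E$. 1. There is exactly one determinantal linear process on $(E,\sigma)$ with kernel $\mathsf k$; it is denoted by $\mu_{\sigma,\mathsf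 k}$. Moreover, for every orthonormal basis of $E$ obtained by putting together orthonormal bases of the blocks of $\sigma$, there is exactly one law of a DPP with kernel the matrix of $\mathsf k$ in that basis. 2. (Sampling.) In each block of $\sigma$ choose, independently, a Haar-uniform orthonormal basis, and put these bases together into a random orthonormal basis $(e_p)_{p\in S}$ of $E$. Let $K$ be the matrix of $\mathsf k$ in this basis and, given the basis, sample the DPP $X\subseteq S$ with kernel $K$. Then the random subspace $\mathrm{Vect}(e_p:p\in X)$ is distributed according to $\mu_{\sigma,\mathsf k}$. 3. (Averaging.) For every splitting $\delta$ of $E$ that is finer than $\sigma$, the following equality of measures on $\mathsf{Gr}(E,\sigma)$ holds, where $\mu_{u(\delta),\mathsf k}$ is seen as a measure on $\mathsf{Gr}(E,\sigma)$ through $\mathsf{Gr}(E,u(\delta))\subseteq \mathsf{Gr}(E,\sigma)$: $$\mu_{\sigma,\mathsf k}=\int_{\mathrm U(E,\sigma)}\mu_{u(\delta),\mathsf k}\,\mathrm du .$$ -/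

import Mathlib

open MeasureTheory Module
open scoped ENNReal NNReal

noncomputable section

namespace DLP

/-! ### The isometry group of an inner product space and its normalised Haar measure -/

section Isometries

variable {𝕜 E : Type*} [RCLike 𝕜] [NormedAddCommGroup E] [InnerProductSpace 𝕜 E]

/-- An isometry, seen as an endomorphism. -/
def isoToEnd (u : E ≃ₗᵢ[𝕜] E) : E →L[𝕜] E := (u.toContinuousLinearEquiv : E →L[𝕜] E)

@[simp] lemma isoToEnd_apply (u : E ≃ₗᵢ[𝕜] E) (x : E) : isoToEnd u x = u x := rfl

/-- The isometry group carries the topology of the operator norm. -/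
instance isoTopology : TopologicalSpace (E ≃ₗᵢ[𝕜] E) :=
  TopologicalSpace.induced isoToEnd inferInstance

instance isoMeasurableSpace : MeasurableSpace (E ≃ₗᵢ[𝕜] E) := borel _

instance isoBorelSpace : BorelSpace (E ≃ₗᵢ[𝕜] E) := ⟨rfl⟩

lemma isInducing_isoToEnd :
    Topology.IsInducing (isoToEnd : (E ≃ₗᵢ[𝕜] E) → (E →L[𝕜] E)) := ⟨rfl⟩

lemma continuous_isoToEnd : Continuous (isoToEnd : (E ≃ₗᵢ[𝕜] E) → (E →L[𝕜] E)) :=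
  isInducing_isoToEnd.continuous

lemma dist_inv_le (u v : E ≃ₗᵢ[𝕜] E) :
    dist (isoToEnd u⁻¹) (isoToEnd v⁻¹) ≤ dist (isoToEnd u) (isoToEnd v) := by
  rw [dist_eq_norm, dist_eq_norm, ← norm_neg (isoToEnd u - isoToEnd v)]
  refine ContinuousLinearMap.opNorm_le_bound _ (norm_nonneg _) fun x => ?_
  have h1 : ‖u⁻¹ x - v⁻¹ x‖ = ‖x - u (v⁻¹ x)‖ := by
    rw [← u.norm_map (u⁻¹ x - v⁻¹ x), map_sub]
    congr 2
    exact u.apply_symm_apply x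
  have h2 : x - u (v⁻¹ x) = (-(isoToEnd u - isoToEnd v)) (v⁻¹ x) := by
    have : v (v⁻¹ x) = x := v.apply_symm_apply x
    simp only [neg_sub, sub_apply, isoToEnd_apply, this]
  have h3 : ‖v⁻¹ x‖ = ‖x‖ := (v⁻¹).norm_map x
  calc ‖(isoToEnd u⁻¹ - isoToEnd v⁻¹) x‖ = ‖u⁻¹ x - v⁻¹ x‖ := rfl
    _ = ‖(-(isoToEnd u - isoToEnd v)) (v⁻¹ x)‖ := by rw [h1, h2]
    _ ≤ ‖-(isoToEnd u - isoToEnd v)‖ * ‖v⁻¹ x‖ := ContinuousLinearMap.le_opNorm _ _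
    _ = _ := by rw [h3]

instance isoTopologicalGroup : IsTopologicalGroup (E ≃ₗᵢ[𝕜] E) where
  continuous_mul := by
    refine continuous_induced_rng.2 ?_
    have : (isoToEnd ∘ fun p : (E ≃ₗᵢ[𝕜] E) × (E ≃ₗᵢ[𝕜] E) => p.1 * p.2) =
        fun p => (isoToEnd p.1).comp (isoToEnd p.2) := rfl
    rw [this]
    exact (continuous_isoToEnd.comp continuous_fst).clm_comp
      (continuous_isoToEnd.comp continuous_snd)
  continuous_inv := by
    refine continuous_induced_rng.2 (continuous_iff_continuousAt.2 fun u => ?_)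
    refine tendsto_iff_dist_tendsto_zero.2 ?_
    refine squeeze_zero (fun _ => dist_nonneg) (fun v => dist_inv_le v u) ?_
    exact tendsto_iff_dist_tendsto_zero.1 continuous_isoToEnd.continuousAt

instance isoCompactSpace [FiniteDimensional 𝕜 E] : CompactSpace (E ≃ₗᵢ[𝕜] E) := by
  have : ProperSpace (E →L[𝕜] E) := FiniteDimensional.proper 𝕜 _
  rw [← isCompact_univ_iff, isInducing_isoToEnd.isCompact_iff, Set.image_univ]
  have hr : Set.range (isoToEnd : (E ≃ₗᵢ[𝕜] E) → (E →L[𝕜] E)) =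
      {T | ∀ x, ‖T x‖ = ‖x‖} := by
    ext T
    constructor
    · rintro ⟨u, rfl⟩ x
      exact u.norm_map x
    · intro hT
      refine ⟨LinearIsometry.toLinearIsometryEquiv ⟨T.toLinearMap, hT⟩ rfl, ?_⟩
      ext x
      rfl
  rw [hr]
  refine Metric.isCompact_of_isClosed_isBounded ?_ ?_
  · simp only [Set.ofPred_forall]
    exact isClosed_iInter fun x => isClosed_eq (by fun_prop) continuous_const
  · refine (Metric.isBounded_closedBall (x := (0 : E →L[𝕜] E)) (r := 1)).subset fun T hT => ?_
    rw [mem_closedBall_zero_iff]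
    exact ContinuousLinearMap.opNorm_le_bound _ zero_le_one fun x => by
      rw [one_mul]; exact (hT x).le

end Isometries

/-- The normalised Haar measure of a compact group. -/
def haarProb (G : Type*) [Group G] [TopologicalSpace G] [IsTopologicalGroup G] [CompactSpace G]
    [MeasurableSpace G] [BorelSpace G] : Measure G :=
  Measure.haarMeasure (⊤ : TopologicalSpace.PositiveCompacts G)

/-! ### Split inner product spaces and their Grassmannians -/

/-- A splitting of `E`: a family of pairwise orthogonal subspaces of which `E` is the direct sum.
Blocks equal to `0` are allowed, so that the splitting induced on an adapted subspace is one. -/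
structure Splitting (𝕜 E : Type*) [RCLike 𝕜] [NormedAddCommGroup E] [InnerProductSpace 𝕜 E]
    (ι : Type*) where
  block : ι → Submodule 𝕜 E
  orthogonal : Pairwise fun i j => block i ⟂ block j
  iSup_eq_top : ⨆ i, block i = ⊤

section Split

variable {𝕜 E ι κ : Type*} [RCLike 𝕜] [NormedAddCommGroup E] [InnerProductSpace 𝕜 E]

namespace Splitting

/-- A subspace is adapted to `σ` if it is the (orthogonal) sum of its intersections with the
blocks of `σ`. -/
def IsAdapted (σ : Splitting 𝕜 E ι) (Q : Submodule 𝕜 E) : Prop :=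
  Q = ⨆ i, Q ⊓ σ.block i

lemma isAdapted_of_le {σ : Splitting 𝕜 E ι} {Q : Submodule 𝕜 E}
    (h : Q ≤ ⨆ i, Q ⊓ σ.block i) : σ.IsAdapted Q :=
  le_antisymm h (iSup_le fun _ => inf_le_left)

/-- `δ` is finer than `σ`: each block of `δ` is contained in a block of `σ`. -/
def Finer (δ : Splitting 𝕜 E κ) (σ : Splitting 𝕜 E ι) : Prop :=
  ∀ j, ∃ i, δ.block j ≤ σ.block i

/-- The image `u(δ)` of a splitting under an isometry. -/
def image (δ : Splitting 𝕜 E κ) (u : E ≃ₗᵢ[𝕜] E) : Splitting 𝕜 E κ where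
  block j := (δ.block j).map (u.toLinearEquiv : E →ₗ[𝕜] E)
  orthogonal i j hij := by
    refine Submodule.isOrtho_iff_inner_eq.2 ?_
    rintro _ ⟨x, hx, rfl⟩ _ ⟨y, hy, rfl⟩
    have := Submodule.isOrtho_iff_inner_eq.1 (δ.orthogonal hij) x hx y hy
    simpa using this
  iSup_eq_top := by
    rw [← Submodule.map_iSup, δ.iSup_eq_top, Submodule.map_top]
    exact LinearMap.range_eq_top.2 u.surjective

/-- The stabiliser `U(E, σ)` of a splitting in the isometry group of `E`. -/
def stab (σ : Splitting 𝕜 E ι) : Subgroup (E ≃ₗᵢ[𝕜] E) where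
  carrier := {u | ∀ i, (σ.block i).map (u.toLinearEquiv : E →ₗ[𝕜] E) = σ.block i}
  one_mem' i := Submodule.map_id _
  mul_mem' {u v} hu hv i := by
    have : ((u * v).toLinearEquiv : E →ₗ[𝕜] E) =
        (u.toLinearEquiv : E →ₗ[𝕜] E) ∘ₗ (v.toLinearEquiv : E →ₗ[𝕜] E) := rfl
    rw [this, Submodule.map_comp, hv i, hu i]
  inv_mem' {u} hu i := by
    have : (u⁻¹.toLinearEquiv : E →ₗ[𝕜] E) ∘ₗ (u.toLinearEquiv : E →ₗ[𝕜] E) =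
        LinearMap.id := by
      ext x
      exact u.symm_apply_apply x
    calc (σ.block i).map (u⁻¹.toLinearEquiv : E →ₗ[𝕜] E)
        = ((σ.block i).map (u.toLinearEquiv : E →ₗ[𝕜] E)).map
            (u⁻¹.toLinearEquiv : E →ₗ[𝕜] E) := by rw [hu i]
      _ = σ.block i := by rw [← Submodule.map_comp, this, Submodule.map_id]

lemma image_finer {δ : Splitting 𝕜 E κ} {σ : Splitting 𝕜 E ι} (h : δ.Finer σ) (u : σ.stab) :
    (δ.image u).Finer σ := fun j => by
  obtain ⟨i, hi⟩ := h j
  exact ⟨i, (Submodule.map_mono hi).trans (u.2 i).le⟩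

lemma isClosed_stab [FiniteDimensional 𝕜 E] (σ : Splitting 𝕜 E ι) :
    IsClosed (σ.stab : Set (E ≃ₗᵢ[𝕜] E)) := by
  have : (σ.stab : Set (E ≃ₗᵢ[𝕜] E)) =
      ⋂ i, ⋂ x : σ.block i, {u | isoToEnd u (x : E) ∈ σ.block i} := by
    ext u
    simp only [Set.mem_iInter, Set.mem_ofPred_eq, SetLike.mem_coe]
    constructor
    · intro hu i x
      exact (hu i).le ⟨x, x.2, rfl⟩
    · intro hu i
      refine Submodule.eq_of_le_of_finrank_eq ?_ (LinearEquiv.finrank_map_eq u.toLinearEquiv _)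
      rintro _ ⟨x, hx, rfl⟩
      exact hu i ⟨x, hx⟩
  rw [this]
  refine isClosed_iInter fun i => isClosed_iInter fun x => ?_
  exact (Submodule.closed_of_finiteDimensional (σ.block i)).preimage
    (continuous_isoToEnd.clm_apply continuous_const)

instance [FiniteDimensional 𝕜 E] (σ : Splitting 𝕜 E ι) : CompactSpace σ.stab :=
  isCompact_iff_compactSpace.1 σ.isClosed_stab.isCompact

lemma orthogonalFamily (σ : Splitting 𝕜 E ι) :
    OrthogonalFamily 𝕜 (fun i => σ.block i) fun i => (σ.block i).subtypeₗᵢ :=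
  OrthogonalFamily.of_pairwise σ.orthogonal

lemma isInternal [DecidableEq ι] [FiniteDimensional 𝕜 E] (σ : Splitting 𝕜 E ι) :
    DirectSum.IsInternal σ.block := by
  rw [σ.orthogonalFamily.isInternal_iff, σ.iSup_eq_top, Submodule.top_orthogonal_eq_bot]

end Splitting

/-- The Grassmannian `Gr(E, σ)` of all subspaces of `E` adapted to `σ`. -/
@[ext]
structure Gr (σ : Splitting 𝕜 E ι) where
  toSubmodule : Submodule 𝕜 E
  isAdapted : σ.IsAdapted toSubmodule

namespace Gr

/-- The topology of the Grassmannian, obtained by identifying a subspace with the orthogonal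
projection on it. -/
instance [FiniteDimensional 𝕜 E] (σ : Splitting 𝕜 E ι) : TopologicalSpace (Gr σ) :=
  TopologicalSpace.induced (fun Q => Q.1.starProjection) inferInstance

instance [FiniteDimensional 𝕜 E] (σ : Splitting 𝕜 E ι) : MeasurableSpace (Gr σ) := borel _

instance [FiniteDimensional 𝕜 E] (σ : Splitting 𝕜 E ι) : BorelSpace (Gr σ) := ⟨rfl⟩

/-- The inclusion of `Gr(E, δ)` in `Gr(E, σ)` when `δ` is finer than `σ`. -/
def incl {δ : Splitting 𝕜 E κ} {σ : Splitting 𝕜 E ι} (h : δ.Finer σ) (Q : Gr δ) : Gr σ :=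
  ⟨Q.1, Splitting.isAdapted_of_le <| by
    conv_lhs => rw [Q.2]
    refine iSup_le fun j => ?_
    obtain ⟨i, hi⟩ := h j
    exact (inf_le_inf_left _ hi).trans (le_iSup (fun i => Q.1 ⊓ σ.block i) i)⟩

/-- The action of `U(E, σ)` on `Gr(E, σ)`. -/
def act {σ : Splitting 𝕜 E ι} (u : σ.stab) (Q : Gr σ) : Gr σ :=
  ⟨Q.1.map (u.1.toLinearEquiv : E →ₗ[𝕜] E), Splitting.isAdapted_of_le <| by
    conv_lhs => rw [Q.2, Submodule.map_iSup]
    refine iSup_mono fun i => le_inf (Submodule.map_mono inf_le_left) ?_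
    exact (Submodule.map_mono inf_le_right).trans (u.2 i).le⟩

/-- The splitting `σ_Q` induced by `σ` on an adapted subspace `Q`, with blocks `Q ∩ E_i`. -/
def induced {σ : Splitting 𝕜 E ι} (Q : Gr σ) : Splitting 𝕜 Q.1 ι where
  block i := (σ.block i).comap Q.1.subtype
  orthogonal i j hij := by
    refine Submodule.isOrtho_iff_inner_eq.2 ?_
    intro x hx y hy
    exact Submodule.isOrtho_iff_inner_eq.1 (σ.orthogonal hij) x hx y hy
  iSup_eq_top := by
    apply Submodule.map_injective_of_injective Q.1.injective_subtype
    rw [Submodule.map_iSup, Submodule.map_top, Submodule.range_subtype]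
    simp only [Submodule.map_comap_subtype]
    exact Q.2.symm

/-- The inclusion of `Gr(Q, σ_Q)` in `Gr(E, σ)`. -/
def ofInduced {σ : Splitting 𝕜 E ι} (Q : Gr σ) (R : Gr Q.induced) : Gr σ :=
  ⟨R.1.map Q.1.subtype, Splitting.isAdapted_of_le <| by
    conv_lhs => rw [R.2, Submodule.map_iSup]
    refine iSup_mono fun i => le_inf (Submodule.map_mono inf_le_left) ?_
    exact (Submodule.map_mono inf_le_right).trans (Submodule.map_comap_le _ _)⟩

end Gr

/-! ### Invariant measures on Grassmannians and incidence measures -/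

/-- A reference point of the stratum of `Gr(E, σ)` with split dimension `n`: in each block, the
span of the first `n i` vectors of an orthonormal basis. -/
def stdPoint [FiniteDimensional 𝕜 E] (σ : Splitting 𝕜 E ι)
    (n : ∀ i, Fin (finrank 𝕜 (σ.block i) + 1)) : Gr σ :=
  ⟨⨆ i, Submodule.span 𝕜 ((fun j => (stdOrthonormalBasis 𝕜 (σ.block i) j : E)) ''
      {j | (j : ℕ) < n i}),
    Splitting.isAdapted_of_le <| iSup_mono fun i => le_inf (le_iSup_of_le i le_rfl) <|
      Submodule.span_le.2 <| by
        rintro _ ⟨j, -, rfl⟩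
        exact Subtype.coe_prop _⟩

/-- The measure on the stratum of `Gr(E, σ)` with split dimension `n` that is invariant under
`U(E, σ)` and has total mass `∏ i, (d i).choose (n i)`, where `d i` is the dimension of the block
`i`: as the action is transitive, it is a multiple of the image of the Haar measure. -/
def nuStratum [Fintype ι] [FiniteDimensional 𝕜 E] (σ : Splitting 𝕜 E ι)
    (n : ∀ i, Fin (finrank 𝕜 (σ.block i) + 1)) : Measure (Gr σ) :=
  ((∏ i, (finrank 𝕜 (σ.block i)).choose (n i) : ℕ) : ℝ≥0∞) •
    (haarProb σ.stab).map fun u => Gr.act u (stdPoint σ n)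

open scoped Classical in
/-- The invariant measure `ν^{E,σ}` on `Gr(E, σ)`. -/
def nu [Fintype ι] [FiniteDimensional 𝕜 E] (σ : Splitting 𝕜 E ι) : Measure (Gr σ) :=
  ∑ n : (∀ i, Fin (finrank 𝕜 (σ.block i) + 1)), nuStratum σ n

/-- The incidence measure `∫ ν^{Q,σ_Q} dμ(Q)` of a measure `μ` on `Gr(E, σ)`. -/
def incidence [Fintype ι] [FiniteDimensional 𝕜 E] {σ : Splitting 𝕜 E ι} (μ : Measure (Gr σ)) :
    Measure (Gr σ) :=
  μ.bind fun Q => (nu Q.induced).map Q.ofInduced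

/-! ### Determinantal linear processes -/

/-- The compression of an endomorphism `k` of `E` to a subspace `Q`. -/
def compression [FiniteDimensional 𝕜 E] (k : E →ₗ[𝕜] E) (Q : Submodule 𝕜 E) : Q →ₗ[𝕜] Q :=
  (Q.orthogonalProjectionOnto : E →ₗ[𝕜] Q) ∘ₗ k ∘ₗ Q.subtype

/-- A kernel: a self-adjoint endomorphism `k` such that `0 ≤ k ≤ 1`. -/
def IsKernel (k : E →ₗ[𝕜] E) : Prop := k.IsPositive ∧ (1 - k).IsPositive

/-- `μ` is a determinantal linear process on `(E, σ)` with kernel `k`: it is a probability measure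
and its incidence measure has the density `Q ↦ det k_Q^Q` with respect to `ν^{E,σ}`. -/
def IsDLP [Fintype ι] [FiniteDimensional 𝕜 E] (σ : Splitting 𝕜 E ι) (k : E →ₗ[𝕜] E)
    (μ : Measure (Gr σ)) : Prop :=
  IsProbabilityMeasure μ ∧
    ∃ f : Gr σ → ℝ≥0, Measurable f ∧
      (∀ Q, ((f Q : ℝ) : 𝕜) = LinearMap.det (compression k Q.1)) ∧
      incidence μ = (nu σ).withDensity fun Q => (f Q : ℝ≥0∞)

open scoped Classical in
/-- The measure `μ_{σ,k}`: the determinantal linear process on `(E, σ)` with kernel `k`. -/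
def dlp [Fintype ι] [FiniteDimensional 𝕜 E] (σ : Splitting 𝕜 E ι) (k : E →ₗ[𝕜] E) :
    Measure (Gr σ) :=
  if h : ∃ μ, IsDLP σ k μ then h.choose else 0

/-! ### Finite determinantal point processes -/

open scoped Classical in
/-- `ρ` is (the law of) a determinantal point process on `S` with kernel `K`. -/
def IsDPP {S : Type*} [Fintype S] (K : Matrix S S 𝕜) (ρ : Measure (Finset S)) : Prop :=
  IsProbabilityMeasure ρ ∧
    ∀ J : Finset S, ((ρ.real {X | J ⊆ X} : ℝ) : 𝕜) =
      (K.submatrix (Subtype.val : J → S) (Subtype.val : J → S)).det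

open scoped Classical in
/-- The law of the determinantal point process with kernel `K`. -/
def dpp {S : Type*} [Fintype S] (K : Matrix S S 𝕜) : Measure (Finset S) :=
  if h : ∃ ρ, IsDPP K ρ then h.choose else 0

/-! ### The sampling procedure -/

/-- Orthonormal bases are topologised as tuples of vectors. -/
instance onbTopology {S : Type*} [Fintype S] : TopologicalSpace (OrthonormalBasis S 𝕜 E) :=
  TopologicalSpace.induced (fun b (j : S) => b j) inferInstance

instance onbMeasurableSpace {S : Type*} [Fintype S] :
    MeasurableSpace (OrthonormalBasis S 𝕜 E) := borel _

instance onbBorelSpace {S : Type*} [Fintype S] :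
    BorelSpace (OrthonormalBasis S 𝕜 E) := ⟨rfl⟩

variable (𝕜 E) in
/-- The law of a uniform random orthonormal basis of `E`: the image of the Haar measure on the
isometry group, which acts simply transitively on orthonormal bases. -/
def uniformONB [FiniteDimensional 𝕜 E] :
    Measure (OrthonormalBasis (Fin (finrank 𝕜 E)) 𝕜 E) :=
  (haarProb (E ≃ₗᵢ[𝕜] E)).map fun u => (stdOrthonormalBasis 𝕜 E).map u

/-- Families of orthonormal bases of the blocks of `σ`. -/
abbrev BlockBases (σ : Splitting 𝕜 E ι) : Type _ :=
  ∀ i, OrthonormalBasis (Fin (finrank 𝕜 (σ.block i))) 𝕜 (σ.block i)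

/-- The set labelling the vectors of a basis of `E` made of bases of the blocks of `σ`. -/
abbrev Labels (σ : Splitting 𝕜 E ι) : Type _ := Σ i, Fin (finrank 𝕜 (σ.block i))

open scoped Classical in
/-- The orthonormal basis of `E` obtained by aggregating orthonormal bases of the blocks. -/
def aggregate [Fintype ι] [FiniteDimensional 𝕜 E] (σ : Splitting 𝕜 E ι) (b : BlockBases σ) :
    OrthonormalBasis (Labels σ) 𝕜 E :=
  σ.isInternal.collectedOrthonormalBasis σ.orthogonalFamily b

open scoped Classical in
/-- The matrix of `k` in the aggregated basis. -/
def kernelMatrix [Fintype ι] [FiniteDimensional 𝕜 E] (σ : Splitting 𝕜 E ι) (k : E →ₗ[𝕜] E)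
    (b : BlockBases σ) : Matrix (Labels σ) (Labels σ) 𝕜 :=
  LinearMap.toMatrixOrthonormal (aggregate σ b) k

/-- The subspace spanned by the selected basis vectors. -/
def selectedSpan [Fintype ι] [FiniteDimensional 𝕜 E] (σ : Splitting 𝕜 E ι) (b : BlockBases σ)
    (X : Finset (Labels σ)) : Gr σ :=
  ⟨Submodule.span 𝕜 (aggregate σ b '' X), Splitting.isAdapted_of_le <| Submodule.span_le.2 <| by
    classical
    rintro _ ⟨p, hp, rfl⟩
    refine Submodule.mem_iSup_of_mem p.1 ⟨Submodule.subset_span ⟨p, hp, rfl⟩, ?_⟩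
    exact σ.isInternal.collectedOrthonormalBasis_mem σ.orthogonalFamily b p⟩

/-- The law of the random subspace produced by the sampling procedure: pick independent uniform
orthonormal bases of the blocks; given these, pick a random set of labels according to the
determinantal point process with kernel the matrix of `k` in the aggregated basis; output the span
of the selected basis vectors. -/
def samplingLaw [Fintype ι] [FiniteDimensional 𝕜 E] (σ : Splitting 𝕜 E ι) (k : E →ₗ[𝕜] E) :
    Measure (Gr σ) :=
  (Measure.pi fun i => uniformONB 𝕜 (σ.block i)).bind fun b =>
    (dpp (kernelMatrix σ k b)).map (selectedSpan σ b)

end Split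

end DLP

end

open MeasureTheory Module
open scoped ENNReal NNReal

noncomputable section

namespace DLP

/-! ### Determinants of endomorphisms glued along a subspace -/

section Determinants

variable {𝕜 E : Type*} [RCLike 𝕜] [NormedAddCommGroup E] [InnerProductSpace 𝕜 E]

local notation "⟪" x ", " y "⟫" => inner 𝕜 x y

/-! Write P for the orthogonal projection on Q. The process has an explicit density with respect to
ν, given by one function for all splittings: w(Q) = det(kP + (1 - k)(1 - P)), which is `mixedDet k
(1 - k) Q`, or `weight` as a nonnegative real. For Q spanned by the vectors e_p, p ∈ X, of an
orthonormal basis e, the row of index p of this determinant comes from k if p ∈ X and from 1 - k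
otherwise. Multilinearity in the rows therefore gives Σ_{X ⊇ J} w(span e_X) = det(kP_J + 1 - P_J),
the determinant of the compression of k to span e_J (`sum_mixedDet_span_image`,
`mixedDet_one_eq_det_compression`). Positivity of w follows from 2(kP + (1 - k)(1 - P)) = 1 + (2k -
1)(2P - 1), where 2k - 1 and 2P - 1 are self-adjoint contractions (`det_one_add_comp_nonneg`). So
the numbers w(span e_X) are the point probabilities of the DPP attached to e.

The link with subspaces is `nu_eq_sum_orbitMeasure`: for any basis e adapted to σ, ν is the sum over
X of the laws of u(span e_X), u being Haar-uniform in U(E,σ), because the binomial coefficients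
count the subsets X of given split dimension. Integrals against ν are thus averages over u of finite
sums over subsets of the rotated basis u(e).

Incidence: for Q = span e_X, the measure of Q's adapted subspaces is the sum over Y ⊆ X of the laws
of v(span e_Y), v uniform in U(Q,σ_Q). Extended by the identity, v fixes Q, and right invariance
absorbs it into u; the finite identity then yields the density det k_Q^Q. Uniqueness: the incidence
transform is triangular with respect to dimension, since that measure has mass 1 at Q and otherwise
charges only smaller dimensions (`incidence_injective`).

Sampling: a uniform element of U(E,σ) restricts to independent uniform isometries of the blocks.
Averaging: a basis adapted to δ is adapted to σ, and U(E,δ) ≤ U(E,σ), so both sides are the same sum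
over subsets of one basis. -/

lemma mem_span_image_iff_inner {S : Type*} [Fintype S] (e : OrthonormalBasis S 𝕜 E) (X : Set S)
    (x : E) : x ∈ Submodule.span 𝕜 (e '' X) ↔ ∀ p ∉ X, ⟪e p, x⟫ = 0 := by
  rw [← e.coe_toBasis, e.toBasis.mem_span_image]
  simp only [Set.subset_def, Finset.mem_coe, Finsupp.mem_support_iff, e.coe_toBasis_repr_apply,
    e.repr_apply_apply]
  exact forall_congr' fun p => not_imp_comm

open scoped Classical in
lemma starProjection_span_image {S : Type*} [Fintype S] [FiniteDimensional 𝕜 E]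
    (e : OrthonormalBasis S 𝕜 E) (X : Set S) (p : S) :
    (Submodule.span 𝕜 (e '' X)).starProjection (e p) = if p ∈ X then e p else 0 := by
  split_ifs with h
  · exact Submodule.starProjection_eq_self_iff.2 (Submodule.subset_span ⟨p, h, rfl⟩)
  · rw [Submodule.starProjection_apply_eq_zero_iff, Submodule.mem_orthogonal']
    exact fun u hu => (mem_span_image_iff_inner e X u).1 hu p h

/-- The determinant of the endomorphism which agrees with `a` on `Q` and with `b` on `Qᗮ`. -/
def mixedDet [FiniteDimensional 𝕜 E] (a b : E →ₗ[𝕜] E) (Q : Submodule 𝕜 E) : 𝕜 :=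
  LinearMap.det (a ∘ₗ (Q.starProjection : E →ₗ[𝕜] E) +
    b ∘ₗ (1 - (Q.starProjection : E →ₗ[𝕜] E)))

-- The projection keeps or kills each basis vector. The matrix is transposed so that images of basis
-- vectors are rows, in which Mathlib's determinant is an alternating map.
open scoped Classical in
lemma mixedDet_span_image [FiniteDimensional 𝕜 E] {S : Type*} [Fintype S]
    (e : OrthonormalBasis S 𝕜 E) (a b : E →ₗ[𝕜] E) (X : Finset S) :
    mixedDet a b (Submodule.span 𝕜 (e '' X)) =
      (Matrix.of fun i j => if i ∈ X then ⟪e j, a (e i)⟫ else ⟪e j, b (e i)⟫).det := by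
  rw [mixedDet, ← LinearMap.det_toMatrix e.toBasis, ← Matrix.det_transpose]
  congr 1
  ext i j
  rw [Matrix.transpose_apply, LinearMap.toMatrix_apply, e.coe_toBasis_repr_apply,
    e.repr_apply_apply, e.coe_toBasis]
  simp only [LinearMap.add_apply, LinearMap.comp_apply, LinearMap.sub_apply, Module.End.one_apply,
    ContinuousLinearMap.coe_coe, starProjection_span_image, Matrix.of_apply, Finset.mem_coe]
  split_ifs <;> simp

-- Outside J, each row of the identity splits into a row of k plus a row of 1 - k; multilinear
-- expansion gives one term for each choice of rows.
open scoped Classical in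
lemma sum_mixedDet_span_image [FiniteDimensional 𝕜 E] {S : Type*} [Fintype S]
    (e : OrthonormalBasis S 𝕜 E) (k : E →ₗ[𝕜] E) (J : Finset S) :
    ∑ X : Finset S with J ⊆ X, mixedDet k (1 - k) (Submodule.span 𝕜 (e '' X)) =
      mixedDet k 1 (Submodule.span 𝕜 (e '' J)) := by
  set m : S → S → 𝕜 := fun i j => ⟪e j, k (e i)⟫
  -- The value 0 on J kills every term of the expansion whose X does not contain J.
  set m' : S → S → 𝕜 := fun i j => if i ∈ J then 0 else ⟪e j, e i - k (e i)⟫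
  have h := (Matrix.detRowAlternating (n := S) (R := 𝕜)).map_add_univ m m'
  have h1 : ∀ X : Finset S, J ⊆ X → mixedDet k (1 - k) (Submodule.span 𝕜 (e '' X)) =
      Matrix.detRowAlternating (X.piecewise m m') := by
    intro X hX
    rw [mixedDet_span_image]
    refine congrArg Matrix.det ?_
    ext i j
    by_cases hi : i ∈ X
    · simp [m, hi]
    · have : i ∉ J := fun h => hi (hX h)
      simp [m', hi, this]
  have h2 : ∀ X : Finset S, ¬ J ⊆ X → Matrix.detRowAlternating (X.piecewise m m') = 0 := by
    intro X hX
    obtain ⟨i, hiJ, hiX⟩ := Finset.not_subset.1 hX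
    refine (Matrix.detRowAlternating (n := S) (R := 𝕜)).map_coord_zero i ?_
    ext j
    simp [m', hiJ, hiX]
  rw [Finset.sum_filter]
  calc _ = ∑ X : Finset S, Matrix.detRowAlternating (X.piecewise m m') :=
        Finset.sum_congr rfl fun X _ => by
          split_ifs with hX
          · exact h1 X hX
          · exact (h2 X hX).symm
    _ = _ := by
        rw [← h, mixedDet_span_image]
        refine congrArg Matrix.det ?_
        ext i j
        by_cases hi : i ∈ J
        · simp [m, m', hi]
        · simp [m, m', hi, inner_sub_right]

-- The rows outside J are those of the identity, so the matrix is block triangular with one trivial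
-- diagonal block.
open scoped Classical in
lemma mixedDet_one_span_image [FiniteDimensional 𝕜 E] {S : Type*} [Fintype S]
    (e : OrthonormalBasis S 𝕜 E) (k : E →ₗ[𝕜] E) (J : Finset S) :
    mixedDet k 1 (Submodule.span 𝕜 (e '' J)) =
      ((LinearMap.toMatrixOrthonormal e k).submatrix (Subtype.val : J → S)
        (Subtype.val : J → S)).det := by
  rw [mixedDet_span_image, Matrix.twoBlockTriangular_det _ (fun i => i ∈ J)]
  · have h2 : (Matrix.toSquareBlockProp (Matrix.of fun i j => if i ∈ J then ⟪e j, k (e i)⟫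
        else ⟪e j, (1 : E →ₗ[𝕜] E) (e i)⟫) fun i => ¬ i ∈ J) = 1 := by
      ext i j
      have hi : (i : S) ∉ J := i.2
      simp [Matrix.toSquareBlockProp, Matrix.toBlock_apply, hi, e.inner_eq_ite, Matrix.one_apply,
        Subtype.ext_iff, eq_comm]
    rw [h2, Matrix.det_one, mul_one,
      ← Matrix.det_transpose ((LinearMap.toMatrixOrthonormal e k).submatrix _ _)]
    convert! rfl
    ext i j
    have hi : (i : S) ∈ J := i.2
    simp [Matrix.toSquareBlockProp, Matrix.toBlock_apply, hi, LinearMap.toMatrix_apply,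
      e.repr_apply_apply]
  · intro i hi j hj
    have : j ≠ i := fun h => hi (h ▸ hj)
    simp [hi, e.inner_eq_ite, this]

/-- The **Weinstein–Aronszajn identity** for linear maps. -/
lemma det_one_add_comp_comm {F : Type*} [AddCommGroup F] [Module 𝕜 F] [FiniteDimensional 𝕜 F]
    [FiniteDimensional 𝕜 E] (f : F →ₗ[𝕜] E) (g : E →ₗ[𝕜] F) :
    LinearMap.det (1 + f ∘ₗ g) = LinearMap.det (1 + g ∘ₗ f) := by
  let b := Module.finBasis 𝕜 E
  let c := Module.finBasis 𝕜 F
  rw [← LinearMap.det_toMatrix b, ← LinearMap.det_toMatrix c, map_add, map_add,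
    LinearMap.toMatrix_comp b c b, LinearMap.toMatrix_comp c b c, LinearMap.toMatrix_one,
    LinearMap.toMatrix_one, Matrix.det_one_add_mul_comm]

/-- The operator is 1 + (k - 1) ∘ (inclusion of Q) ∘ (projection to Q); exchanging the factors by
Weinstein–Aronszajn moves the determinant to Q. -/
lemma mixedDet_one_eq_det_compression [FiniteDimensional 𝕜 E] (k : E →ₗ[𝕜] E)
    (Q : Submodule 𝕜 E) : mixedDet k 1 Q = LinearMap.det (compression k Q) := by
  have h1 : k ∘ₗ (Q.starProjection : E →ₗ[𝕜] E) +
      (1 : E →ₗ[𝕜] E) ∘ₗ (1 - (Q.starProjection : E →ₗ[𝕜] E)) =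
      1 + ((k - 1) ∘ₗ Q.subtype) ∘ₗ (Q.orthogonalProjectionOnto : E →ₗ[𝕜] Q) := by
    ext x
    simp
    abel
  have h2 : 1 + (Q.orthogonalProjectionOnto : E →ₗ[𝕜] Q) ∘ₗ ((k - 1) ∘ₗ Q.subtype) =
      compression k Q := by
    ext x
    simp [compression]
  rw [mixedDet, h1, det_one_add_comp_comm, h2]

/-- One has ‖(2k - 1)x‖² = ‖x‖² - 4⟨k(1 - k)x, x⟩, and k(1 - k) = k(1 - k)k + (1 - k)k(1 - k) is a
sum of two positive operators. -/
lemma IsKernel.norm_add_self_sub_le {k : E →ₗ[𝕜] E} (hk : IsKernel k) (x : E) :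
    ‖k x + k x - x‖ ≤ ‖x‖ := by
  obtain ⟨h1, h2⟩ := hk
  have a1 := h2.re_inner_nonneg_left (k x)
  have a2 := h1.re_inner_nonneg_left (x - k x)
  have s1 : ⟪k (k x), x⟫ = ⟪k x, k x⟫ := h1.isSymmetric _ _
  rw [LinearMap.sub_apply, Module.End.one_apply, inner_sub_left, map_sub] at a1
  rw [map_sub, inner_sub_left, inner_sub_right, inner_sub_right, s1] at a2
  simp only [map_sub] at a2
  have h3 : ‖k x + k x - x‖ ^ 2 =
      4 * RCLike.re ⟪k x, k x⟫ - 4 * RCLike.re ⟪k x, x⟫ + ‖x‖ ^ 2 := by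
    have h4 : RCLike.re ⟪x, k x⟫ = RCLike.re ⟪k x, x⟫ := inner_re_symm x (k x)
    rw [← inner_self_eq_norm_sq (𝕜 := 𝕜), ← inner_self_eq_norm_sq (𝕜 := 𝕜)]
    simp only [inner_sub_left, inner_sub_right, inner_add_left, inner_add_right, map_sub, map_add,
      h4]
    ring
  refine (abs_le_of_sq_le_sq' ?_ (norm_nonneg x)).2
  linarith

lemma star_det_eq_det_adjoint [FiniteDimensional 𝕜 E] (T : E →ₗ[𝕜] E) :
    star (LinearMap.det T) = LinearMap.det (LinearMap.adjoint T) := by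
  let e := stdOrthonormalBasis 𝕜 E
  rw [← LinearMap.det_toMatrix e.toBasis T, ← LinearMap.det_toMatrix e.toBasis,
    LinearMap.toMatrix_adjoint, Matrix.det_conjTranspose]

/-- If `A` and `J` are self-adjoint contractions, then `det (1 + A J)` is real and nonnegative. -/
lemma det_one_add_comp_nonneg [FiniteDimensional 𝕜 E] {A J : E →ₗ[𝕜] E}
    (hA : A.IsSymmetric) (hJ : J.IsSymmetric) (hA' : ∀ x, ‖A x‖ ≤ ‖x‖) (hJ' : ∀ x, ‖J x‖ ≤ ‖x‖) :
    ∃ r : ℝ, 0 ≤ r ∧ (r : 𝕜) = LinearMap.det (1 + A ∘ₗ J) := by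
  -- Deform A to sA: the determinant is real, equals 1 at s = 0 and does not vanish before s = 1, so
  -- by the intermediate value theorem it is nonnegative at s = 1.
  set f : ℝ → 𝕜 := fun s => LinearMap.det (1 + ((s : 𝕜) • A) ∘ₗ J) with hf
  -- Conjugation replaces 1 + sAJ by its adjoint 1 + J(sA), which has the same determinant by
  -- Weinstein–Aronszajn.
  have hreal : ∀ s, ((RCLike.re (f s) : ℝ) : 𝕜) = f s := by
    intro s
    refine RCLike.conj_eq_iff_re.1 ?_
    have hadj : LinearMap.adjoint (1 + ((s : 𝕜) • A) ∘ₗ J) = 1 + J ∘ₗ ((s : 𝕜) • A) := by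
      symm
      rw [LinearMap.eq_adjoint_iff]
      intro x y
      simp [inner_add_left, inner_add_right, hJ _ _, hA _ _, inner_smul_left, inner_smul_right]
    calc star (f s) = LinearMap.det (1 + J ∘ₗ ((s : 𝕜) • A)) := by
          rw [hf, star_det_eq_det_adjoint, hadj]
      _ = f s := (det_one_add_comp_comm _ _).symm
  -- A kernel vector satisfies x = -sAJx, hence ‖x‖ ≤ s‖x‖ with s < 1.
  have hne : ∀ s ∈ Set.Ico (0 : ℝ) 1, f s ≠ 0 := by
    intro s hs h0
    obtain ⟨x, hx, hx0⟩ := Submodule.exists_mem_ne_zero_of_ne_bot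
      (LinearMap.bot_lt_ker_of_det_eq_zero h0).ne'
    have h1 : x = -((s : 𝕜) • A (J x)) := by
      have := LinearMap.mem_ker.1 hx
      simp only [LinearMap.add_apply, Module.End.one_apply, LinearMap.comp_apply,
        LinearMap.smul_apply] at this
      exact eq_neg_of_add_eq_zero_left this
    have h2 : ‖x‖ ≤ s * ‖x‖ := by
      calc ‖x‖ = s * ‖A (J x)‖ := by
            conv_lhs => rw [h1]
            rw [norm_neg, norm_smul, RCLike.norm_ofReal, abs_of_nonneg hs.1]
        _ ≤ s * ‖x‖ := mul_le_mul_of_nonneg_left ((hA' _).trans (hJ' _)) hs.1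
    have h3 : 0 < ‖x‖ := norm_pos_iff.2 hx0
    nlinarith [hs.2]
  have hcont : Continuous f := by
    let b := Module.finBasis 𝕜 E
    have : f = fun s : ℝ => (1 + (s : 𝕜) • LinearMap.toMatrix b b (A ∘ₗ J)).det := by
      ext s
      rw [hf]
      dsimp only
      rw [← LinearMap.det_toMatrix b, map_add, LinearMap.toMatrix_one, LinearMap.smul_comp, map_smul]
    rw [this]
    fun_prop
  have h1 : f 1 = LinearMap.det (1 + A ∘ₗ J) := by simp [hf]
  refine ⟨RCLike.re (f 1), ?_, by rw [hreal, h1]⟩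
  by_contra hneg
  have h0 : RCLike.re (f 0) = 1 := by simp [hf]
  obtain ⟨s, hs, hs0⟩ := intermediate_value_Icc' (zero_le_one' ℝ)
    (RCLike.continuous_re.comp hcont).continuousOn
    (show (0 : ℝ) ∈ Set.Icc _ _ from ⟨(not_le.1 hneg).le, by simp [h0]⟩)
  rcases hs.2.lt_or_eq with h | h
  · exact hne s ⟨hs.1, h⟩ (by rw [← hreal]; simpa using hs0)
  · subst h
    exact hneg (le_of_eq hs0.symm)

/-- Up to the factor 2, the operator is 1 + (2k - 1)(2P - 1), and both factors are self-adjoint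
contractions: the first since 0 ≤ k ≤ 1, the second as a reflection. -/
lemma IsKernel.mixedDet_nonneg [FiniteDimensional 𝕜 E] {k : E →ₗ[𝕜] E} (hk : IsKernel k)
    (Q : Submodule 𝕜 E) : ∃ r : ℝ, 0 ≤ r ∧ (r : 𝕜) = mixedDet k (1 - k) Q := by
  set P : E →ₗ[𝕜] E := (Q.starProjection : E →ₗ[𝕜] E) with hP
  have hPs : ∀ x y, ⟪P x, y⟫ = ⟪x, P y⟫ :=
    fun x y => Submodule.inner_starProjection_left_eq_right Q x y
  have hPP : ∀ x, P (P x) = P x := fun x =>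
    Submodule.starProjection_eq_self_iff.2 (Submodule.starProjection_apply_mem Q x)
  have hks : ∀ x y, ⟪k x, y⟫ = ⟪x, k y⟫ := hk.1.isSymmetric
  obtain ⟨r, hr, h⟩ := det_one_add_comp_nonneg (A := k + k - 1) (J := P + P - 1)
    (fun x y => by simp [inner_sub_left, inner_sub_right, inner_add_left, inner_add_right, hks])
    (fun x y => by simp [inner_sub_left, inner_sub_right, inner_add_left, inner_add_right, hPs])
    (fun x => hk.norm_add_self_sub_le x)
    (fun x => by
      refine le_of_eq ((sq_eq_sq₀ (norm_nonneg _) (norm_nonneg _)).1 ?_)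
      have h4 : ⟪P x, P x⟫ = ⟪P x, x⟫ := by rw [← hPs, hPP]
      have h5 : ⟪x, P x⟫ = ⟪P x, x⟫ := (hPs x x).symm
      rw [← inner_self_eq_norm_sq (𝕜 := 𝕜), ← inner_self_eq_norm_sq (𝕜 := 𝕜)]
      congr 1
      simp only [LinearMap.sub_apply, LinearMap.add_apply, Module.End.one_apply, inner_sub_left,
        inner_sub_right, inner_add_left, inner_add_right, h4, h5]
      ring)
  have h1 : (1 : E →ₗ[𝕜] E) + (k + k - 1) ∘ₗ (P + P - 1) =
      (2 : 𝕜) • (k ∘ₗ P + (1 - k) ∘ₗ (1 - P)) := by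
    ext x
    simp
    module
  rw [h1, LinearMap.det_smul] at h
  refine ⟨(2 ^ finrank 𝕜 E)⁻¹ * r, by positivity, ?_⟩
  rw [RCLike.ofReal_mul, h]
  push_cast
  rw [inv_mul_cancel_left₀ (pow_ne_zero _ two_ne_zero)]
  rfl

end Determinants

/-! ### Haar probability measures of compact groups -/

section Haar

variable {G H : Type*} [Group G] [TopologicalSpace G] [IsTopologicalGroup G] [CompactSpace G]
  [MeasurableSpace G] [BorelSpace G] [Group H] [TopologicalSpace H] [IsTopologicalGroup H]
  [CompactSpace H] [MeasurableSpace H] [BorelSpace H]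

instance isHaarMeasure_haarProb : (haarProb G).IsHaarMeasure :=
  Measure.isHaarMeasure_haarMeasure _

instance isProbabilityMeasure_haarProb : IsProbabilityMeasure (haarProb G) :=
  ⟨Measure.haarMeasure_self⟩

lemma map_haarProb_of_surjective (f : G →* H) (hf : Continuous f) (hs : Function.Surjective f) :
    (haarProb G).map f = haarProb H := by
  have := Measure.isHaarMeasure_map_of_isFiniteMeasure (haarProb G) f hf hs
  have := Measure.isProbabilityMeasure_map (μ := haarProb G) hf.aemeasurable
  exact Measure.isHaarMeasure_eq_of_isProbabilityMeasure _ _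

/-- Compact groups are unimodular: a right translate of Haar measure is again a left-invariant
probability measure, and these are unique. -/
instance isMulRightInvariant_haarProb : (haarProb G).IsMulRightInvariant where
  map_mul_right_eq_self g := by
    have := Measure.isProbabilityMeasure_map (μ := haarProb G)
      (continuous_mul_const g).aemeasurable
    exact Measure.isHaarMeasure_eq_of_isProbabilityMeasure _ _

end Haar

/-! ### Topology of isometry groups and of Grassmannians -/

section Topology

variable {𝕜 E F ι κ : Type*} [RCLike 𝕜] [NormedAddCommGroup E] [InnerProductSpace 𝕜 E]
  [NormedAddCommGroup F] [InnerProductSpace 𝕜 F]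

local notation "⟪" x ", " y "⟫" => inner 𝕜 x y

lemma isoToEnd_injective : Function.Injective (isoToEnd : (E ≃ₗᵢ[𝕜] E) → (E →L[𝕜] E)) :=
  fun _ _ h => LinearIsometryEquiv.ext fun x => congrArg (fun T : E →L[𝕜] E => T x) h

/-- Needed for product measurability, and for descending measurability along a surjection in
`measurable_subMeasure`. -/
instance polishSpace_iso [FiniteDimensional 𝕜 E] : PolishSpace (E ≃ₗᵢ[𝕜] E) := by
  have : ProperSpace (E →L[𝕜] E) := FiniteDimensional.proper 𝕜 _
  exact (Topology.IsClosedEmbedding.polishSpace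
    (continuous_isoToEnd.isClosedEmbedding isoToEnd_injective))

instance polishSpace_stab [FiniteDimensional 𝕜 E] (σ : Splitting 𝕜 E ι) : PolishSpace σ.stab :=
  σ.isClosed_stab.polishSpace

namespace Gr

variable [FiniteDimensional 𝕜 E] [FiniteDimensional 𝕜 F]

/-- The orthogonal projection on a point of the Grassmannian. -/
def proj {σ : Splitting 𝕜 E ι} (Q : Gr σ) : E →L[𝕜] E := Q.1.starProjection

lemma isInducing_proj (σ : Splitting 𝕜 E ι) : Topology.IsInducing (proj (σ := σ)) := ⟨rfl⟩

lemma proj_injective (σ : Splitting 𝕜 E ι) : Function.Injective (proj (σ := σ)) :=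
  fun _ _ h => Gr.ext (Submodule.starProjection_inj.1 h)

lemma isEmbedding_proj (σ : Splitting 𝕜 E ι) : Topology.IsEmbedding (proj (σ := σ)) :=
  ⟨isInducing_proj σ, proj_injective σ⟩

lemma continuous_proj (σ : Splitting 𝕜 E ι) : Continuous (proj (σ := σ)) :=
  (isInducing_proj σ).continuous

instance (σ : Splitting 𝕜 E ι) : T2Space (Gr σ) := (isEmbedding_proj σ).t2Space

instance (σ : Splitting 𝕜 E ι) : SecondCountableTopology (Gr σ) := by
  have : ProperSpace (E →L[𝕜] E) := FiniteDimensional.proper 𝕜 _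
  exact (isEmbedding_proj σ).secondCountableTopology

lemma measurable_iff_proj {Ω : Type*} [MeasurableSpace Ω] {σ : Splitting 𝕜 E ι} {f : Ω → Gr σ} :
    Measurable f ↔ Measurable fun ω => (f ω).proj := by
  refine ⟨fun h => (continuous_proj σ).measurable.comp h, fun h => ?_⟩
  refine measurable_of_isOpen fun U hU => ?_
  obtain ⟨V, hV, rfl⟩ := (isInducing_proj σ).isOpen_iff.1 hU
  exact h hV.measurableSet

end Gr

/-- The conjugation formula P ↦ f P f*, source of the continuity of all maps between Grassmannians
used below; `g` plays the role of f*, and can be taken to be the inverse when f is bijective. -/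
lemma starProjection_map_linearIsometry [FiniteDimensional 𝕜 E] [FiniteDimensional 𝕜 F]
    (f : E →ₗᵢ[𝕜] F) (g : F →L[𝕜] E) (h : ∀ x y, ⟪g x, y⟫ = ⟪x, f y⟫) (Q : Submodule 𝕜 E) :
    (Q.map (f : E →ₗ[𝕜] F)).starProjection =
      f.toContinuousLinearMap ∘L Q.starProjection ∘L g := by
  ext x
  refine Submodule.eq_starProjection_of_mem_of_inner_eq_zero
    (Submodule.mem_map_of_mem (Submodule.starProjection_apply_mem Q (g x))) ?_
  rintro _ ⟨y, hy, rfl⟩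
  change ⟪x - f (Q.starProjection (g x)), f y⟫ = 0
  rw [inner_sub_left, f.inner_map_map, ← h, ← inner_sub_left]
  exact Submodule.starProjection_inner_eq_zero _ _ hy

namespace Gr

variable [FiniteDimensional 𝕜 E] [FiniteDimensional 𝕜 F]

/-- The image of adapted subspaces under an isometric embedding which maps each block of a
splitting into a block of another one. -/
def push {σ : Splitting 𝕜 E ι} {τ : Splitting 𝕜 F κ} (f : E →ₗᵢ[𝕜] F)
    (hf : ∀ i, ∃ j, (σ.block i).map (f : E →ₗ[𝕜] F) ≤ τ.block j) (Q : Gr σ) : Gr τ :=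
  ⟨Q.1.map (f : E →ₗ[𝕜] F), Splitting.isAdapted_of_le <| by
    conv_lhs => rw [Q.2, Submodule.map_iSup]
    refine iSup_le fun i => ?_
    obtain ⟨j, hj⟩ := hf i
    exact (le_inf (Submodule.map_mono inf_le_left)
      ((Submodule.map_mono inf_le_right).trans hj)).trans
        (le_iSup (fun j => Q.1.map (f : E →ₗ[𝕜] F) ⊓ τ.block j) j)⟩

lemma continuous_of_toSubmodule_eq_map {σ : Splitting 𝕜 E ι} {τ : Splitting 𝕜 F κ}
    (f : E →ₗᵢ[𝕜] F) {Φ : Gr σ → Gr τ}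
    (hΦ : ∀ Q, (Φ Q).1 = Q.1.map (f : E →ₗ[𝕜] F)) : Continuous Φ := by
  have : CompleteSpace E := FiniteDimensional.complete 𝕜 E
  have : CompleteSpace F := FiniteDimensional.complete 𝕜 F
  refine (isInducing_proj τ).continuous_iff.2 ?_
  have h : proj ∘ Φ = fun Q => f.toContinuousLinearMap ∘L Q.proj ∘L
      ContinuousLinearMap.adjoint f.toContinuousLinearMap := by
    ext1 Q
    refine Eq.trans ?_ (starProjection_map_linearIsometry f _
      (fun x y => ContinuousLinearMap.adjoint_inner_left _ _ _) Q.1)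
    simp only [Function.comp_apply, proj, hΦ]
  rw [h]
  exact continuous_const.clm_comp ((continuous_proj σ).clm_comp continuous_const)

lemma continuous_incl {δ : Splitting 𝕜 E κ} {σ : Splitting 𝕜 E ι} (h : δ.Finer σ) :
    Continuous (incl h) :=
  continuous_of_toSubmodule_eq_map LinearIsometry.id fun Q => (Submodule.map_id Q.1).symm

lemma continuous_ofInduced {σ : Splitting 𝕜 E ι} (Q : Gr σ) : Continuous Q.ofInduced :=
  continuous_of_toSubmodule_eq_map Q.1.subtypeₗᵢ fun _ => rfl

lemma continuous_act (σ : Splitting 𝕜 E ι) :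
    Continuous fun p : σ.stab × Gr σ => act p.1 p.2 := by
  refine (isInducing_proj σ).continuous_iff.2 ?_
  have h : (proj ∘ fun p : σ.stab × Gr σ => act p.1 p.2) = fun p =>
      isoToEnd p.1.1 ∘L p.2.proj ∘L isoToEnd p.1.1⁻¹ := by
    ext1 ⟨u, Q⟩
    refine starProjection_map_linearIsometry u.1.toLinearIsometry _ (fun x y => ?_) Q.1
    rw [← u.1.toLinearIsometry.inner_map_map]
    congr 1
    exact u.1.apply_symm_apply x
  rw [h]
  exact (continuous_isoToEnd.comp (continuous_subtype_val.comp continuous_fst)).clm_comp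
    (((continuous_proj σ).comp continuous_snd).clm_comp (continuous_isoToEnd.comp
      (continuous_subtype_val.comp continuous_fst).inv))

lemma measurable_act (σ : Splitting 𝕜 E ι) :
    Measurable fun p : σ.stab × Gr σ => act p.1 p.2 := (continuous_act σ).measurable

lemma measurable_act_left {σ : Splitting 𝕜 E ι} (Q : Gr σ) :
    Measurable fun u : σ.stab => act u Q := (measurable_act σ).comp measurable_prodMk_right

lemma measurable_act_right {σ : Splitting 𝕜 E ι} (u : σ.stab) :
    Measurable (act u) := (measurable_act σ).comp measurable_prodMk_left

omit [FiniteDimensional 𝕜 E] in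
lemma act_mul {σ : Splitting 𝕜 E ι} (u v : σ.stab) (Q : Gr σ) :
    act (u * v) Q = act u (act v Q) :=
  Gr.ext (Submodule.map_comp (v.1.toLinearEquiv : E →ₗ[𝕜] E) (u.1.toLinearEquiv : E →ₗ[𝕜] E) Q.1)

lemma measurable_of_continuous_proj {σ : Splitting 𝕜 E ι} {α : Type*} [TopologicalSpace α]
    [MeasurableSpace α] [BorelSpace α] {g : (E →L[𝕜] E) → α} (hg : Continuous g) :
    Measurable fun Q : Gr σ => g Q.proj :=
  (hg.comp (continuous_proj σ)).measurable

end Gr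

lemma continuous_linearMap_det [FiniteDimensional 𝕜 E] :
    Continuous fun T : E →L[𝕜] E => LinearMap.det (T : E →ₗ[𝕜] E) := by
  let b := Module.finBasis 𝕜 E
  simp_rw [← LinearMap.det_toMatrix b]
  refine Continuous.matrix_det ?_
  exact LinearMap.continuous_of_finiteDimensional
    ((LinearMap.toMatrix b b).toLinearMap ∘ₗ ContinuousLinearMap.coeLM 𝕜)

lemma measurable_mixedDet [FiniteDimensional 𝕜 E] (σ : Splitting 𝕜 E ι) (a b : E →ₗ[𝕜] E) :
    Measurable fun Q : Gr σ => mixedDet a b Q.1 := by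
  let a' := LinearMap.toContinuousLinearMap a
  let b' := LinearMap.toContinuousLinearMap b
  refine Gr.measurable_of_continuous_proj
    (g := fun P => LinearMap.det ((a' ∘L P + b' ∘L (1 - P) : E →L[𝕜] E) : E →ₗ[𝕜] E)) ?_
  exact continuous_linearMap_det.comp ((continuous_const.clm_comp continuous_id).add
    (continuous_const.clm_comp (continuous_const.sub continuous_id)))

/-- The dimension is the trace of the projection, a continuous function on the Grassmannian. -/
lemma measurableSet_finrank_eq [FiniteDimensional 𝕜 E] (σ : Splitting 𝕜 E ι) (r : ℕ) :
    MeasurableSet {Q : Gr σ | finrank 𝕜 Q.1 = r} := by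
  have h : ∀ Q : Gr σ, LinearMap.trace 𝕜 E (Q.proj : E →ₗ[𝕜] E) = (finrank 𝕜 Q.1 : 𝕜) := by
    intro Q
    have : LinearMap.IsProj Q.1 (Q.proj : E →ₗ[𝕜] E) :=
      ⟨fun x => Submodule.starProjection_apply_mem _ _,
        fun x hx => Submodule.starProjection_eq_self_iff.2 hx⟩
    exact this.trace
  have h2 : {Q : Gr σ | finrank 𝕜 Q.1 = r} =
      (fun Q : Gr σ => LinearMap.trace 𝕜 E (Q.proj : E →ₗ[𝕜] E)) ⁻¹' {(r : 𝕜)} := by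
    ext Q
    simp [h]
  rw [h2]
  refine (Gr.measurable_of_continuous_proj
    (g := fun P : E →L[𝕜] E => LinearMap.trace 𝕜 E (P : E →ₗ[𝕜] E)) ?_) (measurableSet_singleton _)
  exact LinearMap.continuous_of_finiteDimensional
    (LinearMap.trace 𝕜 E ∘ₗ ContinuousLinearMap.coeLM 𝕜)

end Topology

/-! ### Orbits of the stabiliser of a splitting and adapted bases -/

section Orbits

variable {𝕜 E ι κ : Type*} [RCLike 𝕜] [NormedAddCommGroup E] [InnerProductSpace 𝕜 E]

local notation "⟪" x ", " y "⟫" => inner 𝕜 x y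

lemma Splitting.inner_eq_zero (σ : Splitting 𝕜 E ι) {i j : ι} (hij : i ≠ j) {x y : E}
    (hx : x ∈ σ.block i) (hy : y ∈ σ.block j) : ⟪x, y⟫ = 0 :=
  Submodule.isOrtho_iff_inner_eq.1 (σ.orthogonal hij) x hx y hy

lemma Splitting.mem_block_iff (σ : Splitting 𝕜 E ι) {S : Type*} [Fintype S]
    (e : OrthonormalBasis S 𝕜 E) {t : S → ι} (ht : ∀ p, e p ∈ σ.block (t p)) (i : ι) (x : E) :
    x ∈ σ.block i ↔ ∀ p, t p ≠ i → ⟪e p, x⟫ = 0 := by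
  refine ⟨fun hx p hp => σ.inner_eq_zero hp (ht p) hx, fun h => ?_⟩
  rw [← e.sum_repr' x]
  refine Submodule.sum_mem _ fun p _ => ?_
  by_cases hp : t p = i
  · exact Submodule.smul_mem _ _ (hp ▸ ht p)
  · rw [h p hp, zero_smul]
    exact Submodule.zero_mem _

lemma aggregate_apply [Fintype ι] [FiniteDimensional 𝕜 E] (σ : Splitting 𝕜 E ι)
    (b : BlockBases σ) (p : Labels σ) : aggregate σ b p = (b p.1 p.2 : E) := by
  classical
  rw [aggregate, DirectSum.IsInternal.collectedOrthonormalBasis]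
  simp [DirectSum.IsInternal.collectedBasis_coe]

lemma aggregate_mem [Fintype ι] [FiniteDimensional 𝕜 E] (σ : Splitting 𝕜 E ι)
    (b : BlockBases σ) (p : Labels σ) : aggregate σ b p ∈ σ.block p.1 := by
  rw [aggregate_apply]
  exact Subtype.coe_prop _

/-- Two splittings with the same dimensions are isometric. -/
lemma Splitting.exists_isometry [Fintype κ] [FiniteDimensional 𝕜 E] (τ τ' : Splitting 𝕜 E κ)
    (h : ∀ j, finrank 𝕜 (τ.block j) = finrank 𝕜 (τ'.block j)) :
    ∃ u : E ≃ₗᵢ[𝕜] E, ∀ j, (τ.block j).map (u.toLinearEquiv : E →ₗ[𝕜] E) = τ'.block j := by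
  classical
  let b := aggregate τ fun i => stdOrthonormalBasis 𝕜 (τ.block i)
  -- Both bases are indexed by the labels of τ, so matching labels defines an isometry that respects
  -- blocks.
  let b' : OrthonormalBasis (Labels τ) 𝕜 E :=
    (aggregate τ' fun i => stdOrthonormalBasis 𝕜 (τ'.block i)).reindex
      (Equiv.sigmaCongrRight fun j => finCongr (h j).symm)
  have hb' : ∀ p, b' p ∈ τ'.block p.1 := fun p => by
    simp only [b', OrthonormalBasis.reindex_apply]
    exact aggregate_mem τ' (fun i => stdOrthonormalBasis 𝕜 (τ'.block i))
      ((Equiv.sigmaCongrRight fun j => finCongr (h j).symm).symm p)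
  refine ⟨b.equiv b' (Equiv.refl _), fun j => ?_⟩
  refine Submodule.eq_of_le_of_finrank_eq ?_ ?_
  · rintro _ ⟨x, hx, rfl⟩
    rw [τ'.mem_block_iff b' hb']
    intro p hp
    have h1 : b' p = b.equiv b' (Equiv.refl _) (b p) := by simp
    rw [h1]
    exact ((b.equiv b' (Equiv.refl _)).inner_map_map _ _).trans
      (τ.inner_eq_zero hp (aggregate_mem τ _ p) hx)
  · rw [← h j]
    exact LinearEquiv.finrank_map_eq (b.equiv b' (Equiv.refl _)).toLinearEquiv _

namespace Gr

/-- The splitting of `E` by the traces on the blocks of an adapted subspace and of its orthogonal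
complement. -/
def refine [FiniteDimensional 𝕜 E] {σ : Splitting 𝕜 E ι} (Q : Gr σ) :
    Splitting 𝕜 E (ι × Bool) where
  block p := if p.2 then Q.1 ⊓ σ.block p.1 else (Q.1 ⊓ σ.block p.1)ᗮ ⊓ σ.block p.1
  orthogonal := by
    have hle : ∀ p : ι × Bool, (if p.2 then Q.1 ⊓ σ.block p.1 else
        (Q.1 ⊓ σ.block p.1)ᗮ ⊓ σ.block p.1) ≤ σ.block p.1 := fun p => by
      split_ifs <;> exact inf_le_right
    rintro ⟨i, a⟩ ⟨j, b⟩ hij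
    by_cases h : i = j
    · subst h
      have h1 := Submodule.isOrtho_orthogonal_right (Q.1 ⊓ σ.block i)
      cases a <;> cases b
      · exact absurd rfl hij
      · exact (h1.mono_right inf_le_left).symm
      · exact h1.mono_right inf_le_left
      · exact absurd rfl hij
    · exact (σ.orthogonal h).mono (hle _) (hle _)
  iSup_eq_top := by
    rw [iSup_prod, ← σ.iSup_eq_top]
    refine iSup_congr fun i => ?_
    rw [iSup_bool_eq]
    exact Submodule.sup_orthogonal_inf_of_hasOrthogonalProjection inf_le_right

/-- An isometry carrying the refined splitting of Q to that of Q' preserves each block of σ and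
sends Q to Q'; hence the orbits are exactly the strata of given split dimension. -/
lemma exists_act_eq [Fintype ι] [FiniteDimensional 𝕜 E] {σ : Splitting 𝕜 E ι} {Q Q' : Gr σ}
    (h : ∀ i, finrank 𝕜 (Q.1 ⊓ σ.block i : Submodule 𝕜 E) =
      finrank 𝕜 (Q'.1 ⊓ σ.block i : Submodule 𝕜 E)) :
    ∃ u : σ.stab, act u Q = Q' := by
  obtain ⟨u, hu⟩ := Splitting.exists_isometry Q.refine Q'.refine <| by
    rintro ⟨i, a⟩
    cases a
    · have h1 := Submodule.finrank_add_inf_finrank_orthogonal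
        (inf_le_right : Q.1 ⊓ σ.block i ≤ σ.block i)
      have h2 := Submodule.finrank_add_inf_finrank_orthogonal
        (inf_le_right : Q'.1 ⊓ σ.block i ≤ σ.block i)
      have h3 := h i
      change finrank 𝕜 ((Q.1 ⊓ σ.block i)ᗮ ⊓ σ.block i : Submodule 𝕜 E) =
        finrank 𝕜 ((Q'.1 ⊓ σ.block i)ᗮ ⊓ σ.block i : Submodule 𝕜 E)
      omega
    · exact h i
  have hsup : ∀ R : Gr σ, ∀ i, R.refine.block (i, true) ⊔ R.refine.block (i, false) =
      σ.block i := fun R i =>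
    Submodule.sup_orthogonal_inf_of_hasOrthogonalProjection inf_le_right
  refine ⟨⟨u, fun i => ?_⟩, Gr.ext ?_⟩
  · rw [← hsup Q i, Submodule.map_sup, hu, hu, hsup Q' i, hsup Q i]
  · change Q.1.map (u.toLinearEquiv : E →ₗ[𝕜] E) = Q'.1
    conv_rhs => rw [Q'.2]
    conv_lhs => rw [Q.2, Submodule.map_iSup]
    exact iSup_congr fun i => hu (i, true)

/-- The law of the image of a point of the Grassmannian under a uniform element of the stabiliser
of the splitting. -/
def orbitMeasure [FiniteDimensional 𝕜 E] {σ : Splitting 𝕜 E ι} (Q : Gr σ) : Measure (Gr σ) :=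
  (haarProb σ.stab).map fun u => act u Q

instance [FiniteDimensional 𝕜 E] {σ : Splitting 𝕜 E ι} (Q : Gr σ) :
    IsProbabilityMeasure Q.orbitMeasure :=
  Measure.isProbabilityMeasure_map (measurable_act_left Q).aemeasurable

lemma orbitMeasure_act [FiniteDimensional 𝕜 E] {σ : Splitting 𝕜 E ι} (u : σ.stab) (Q : Gr σ) :
    (act u Q).orbitMeasure = Q.orbitMeasure := by
  unfold orbitMeasure
  conv_rhs => rw [← map_mul_right_eq_self (haarProb σ.stab) u,
    Measure.map_map (measurable_act_left Q) (measurable_mul_const u)]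
  simp only [Function.comp_def, act_mul]

lemma orbitMeasure_eq [Fintype ι] [FiniteDimensional 𝕜 E] {σ : Splitting 𝕜 E ι} {Q Q' : Gr σ}
    (h : ∀ i, finrank 𝕜 (Q.1 ⊓ σ.block i : Submodule 𝕜 E) =
      finrank 𝕜 (Q'.1 ⊓ σ.block i : Submodule 𝕜 E)) : Q.orbitMeasure = Q'.orbitMeasure := by
  obtain ⟨u, rfl⟩ := exists_act_eq h
  rw [orbitMeasure_act]

end Gr

/-- The adapted subspace spanned by some of the vectors of an adapted basis. -/
def spanGr (σ : Splitting 𝕜 E ι) {S : Type*} [Fintype S] (e : OrthonormalBasis S 𝕜 E)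
    (he : ∀ p, ∃ i, e p ∈ σ.block i) (X : Finset S) : Gr σ :=
  ⟨Submodule.span 𝕜 (e '' X), Splitting.isAdapted_of_le <| Submodule.span_le.2 <| by
    rintro _ ⟨p, hp, rfl⟩
    obtain ⟨i, hi⟩ := he p
    exact Submodule.mem_iSup_of_mem i ⟨Submodule.subset_span ⟨p, hp, rfl⟩, hi⟩⟩

open scoped Classical in
lemma finrank_span_inf_block (σ : Splitting 𝕜 E ι) {S : Type*} [Fintype S]
    (e : OrthonormalBasis S 𝕜 E) {t : S → ι} (ht : ∀ p, e p ∈ σ.block (t p)) (X : Finset S)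
    (i : ι) : finrank 𝕜 (Submodule.span 𝕜 (e '' X) ⊓ σ.block i : Submodule 𝕜 E) =
      (X.filter fun p => t p = i).card := by
  have h : Submodule.span 𝕜 (e '' X) ⊓ σ.block i =
      Submodule.span 𝕜 (e '' (X.filter fun p => t p = i : Finset S)) := by
    ext x
    rw [Submodule.mem_inf, mem_span_image_iff_inner, mem_span_image_iff_inner,
      σ.mem_block_iff e ht]
    simp only [Finset.mem_coe, Finset.mem_filter, not_and_or]
    exact ⟨fun h p hp => hp.elim (h.1 p) (h.2 p),
      fun h => ⟨fun p hp => h p (Or.inl hp), fun p hp => h p (Or.inr hp)⟩⟩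
  rw [h, ← Finset.coe_image, finrank_span_finset_eq_card,
    Finset.card_image_of_injective _ e.orthonormal.linearIndependent.injective]
  rw [Finset.coe_image]
  exact (e.orthonormal.linearIndependent.linearIndepOn _).id_image

open scoped Classical in
lemma finrank_block_eq_card (σ : Splitting 𝕜 E ι) {S : Type*} [Fintype S]
    (e : OrthonormalBasis S 𝕜 E) {t : S → ι} (ht : ∀ p, e p ∈ σ.block (t p)) (i : ι) :
    finrank 𝕜 (σ.block i) = (Finset.univ.filter fun p => t p = i).card := by
  rw [← finrank_span_inf_block σ e ht Finset.univ i, Finset.coe_univ, Set.image_univ,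
    ← e.coe_toBasis, e.toBasis.span_eq, top_inf_eq]

open scoped Classical in
/-- The number of subsets of a finite set with prescribed intersections with the parts of a
partition. -/
lemma card_filter_card_fiber_eq {S : Type*} [Fintype S] [Fintype ι] (t : S → ι) (n : ι → ℕ) :
    (Finset.univ.filter fun X : Finset S => ∀ i, (X.filter fun p => t p = i).card = n i).card =
      ∏ i, (Finset.univ.filter fun p => t p = i).card.choose (n i) := by
  simp_rw [← Finset.card_powersetCard]
  rw [← Fintype.card_piFinset]
  refine Finset.card_nbij' (fun X i => X.filter fun p => t p = i)
    (fun f => Finset.univ.filter fun p => p ∈ f (t p)) ?_ ?_ ?_ ?_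
  · intro X hX
    simp only [Finset.coe_filter, Finset.mem_univ, true_and, Set.mem_ofPred_eq] at hX
    simp only [Finset.mem_coe, Fintype.mem_piFinset, Finset.mem_powersetCard]
    exact fun i => ⟨Finset.filter_subset_filter _ (Finset.subset_univ _), hX i⟩
  · intro f hf
    simp only [Finset.mem_coe, Fintype.mem_piFinset, Finset.mem_powersetCard] at hf
    simp only [Finset.coe_filter, Finset.mem_univ, true_and, Set.mem_ofPred_eq]
    intro i
    rw [← (hf i).2]
    congr 1
    ext p
    simp only [Finset.mem_filter, Finset.mem_univ, true_and]
    refine ⟨fun h => h.2 ▸ h.1, fun h => ?_⟩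
    have : t p = i := (Finset.mem_filter.1 ((hf i).1 h)).2
    exact ⟨this ▸ h, this⟩
  · intro X _
    ext p
    simp
  · intro f hf
    simp only [Finset.mem_coe, Fintype.mem_piFinset, Finset.mem_powersetCard] at hf
    ext i p
    simp only [Finset.mem_filter, Finset.mem_univ, true_and]
    refine ⟨fun h => h.2 ▸ h.1, fun h => ?_⟩
    have : t p = i := (Finset.mem_filter.1 ((hf i).1 h)).2
    exact ⟨this ▸ h, this⟩

open scoped Classical in
lemma finrank_stdPoint_inf_block [Fintype ι] [FiniteDimensional 𝕜 E] (σ : Splitting 𝕜 E ι)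
    (n : ∀ i, Fin (finrank 𝕜 (σ.block i) + 1)) (i : ι) :
    finrank 𝕜 ((stdPoint σ n).1 ⊓ σ.block i : Submodule 𝕜 E) = n i := by
  let b : BlockBases σ := fun i => stdOrthonormalBasis 𝕜 (σ.block i)
  have h : (stdPoint σ n).1 = Submodule.span 𝕜
      (aggregate σ b '' (Finset.univ.filter fun p : Labels σ => (p.2 : ℕ) < n p.1 : Finset _)) := by
    change ⨆ i, _ = _
    rw [← Submodule.span_iUnion]
    congr 1
    ext x
    simp only [Set.mem_iUnion, Set.mem_image, Finset.coe_filter, Finset.mem_univ, true_and,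
      Set.mem_ofPred_eq, aggregate_apply]
    exact ⟨fun ⟨i, j, hj, hx⟩ => ⟨⟨i, j⟩, hj, hx⟩, fun ⟨p, hp, hx⟩ => ⟨p.1, p.2, hp, hx⟩⟩
  rw [h, finrank_span_inf_block σ (aggregate σ b) (t := Sigma.fst) (aggregate_mem σ b)]
  have hn : (n i : ℕ) ≤ finrank 𝕜 (σ.block i) := Nat.lt_succ_iff.1 (n i).2
  rw [← Fintype.card_fin (n i : ℕ), ← Finset.card_univ]
  symm
  refine Finset.card_bij (fun j _ => (⟨i, Fin.castLE hn j⟩ : Labels σ)) ?_ ?_ ?_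
  · intro j _
    simp
  · intro j _ j' _ h
    simpa using h
  · rintro ⟨i', j⟩ hj
    simp only [Finset.mem_filter, Finset.mem_univ, true_and] at hj
    obtain ⟨hj, rfl⟩ := hj
    exact ⟨⟨j, hj⟩, Finset.mem_univ _, rfl⟩

/-- The invariant measure on the Grassmannian in terms of any adapted basis. -/
lemma nu_eq_sum_orbitMeasure [Fintype ι] [FiniteDimensional 𝕜 E] (σ : Splitting 𝕜 E ι)
    {S : Type*} [Fintype S] (e : OrthonormalBasis S 𝕜 E) (he : ∀ p, ∃ i, e p ∈ σ.block i) :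
    nu σ = ∑ X : Finset S, (spanGr σ e he X).orbitMeasure := by
  classical
  choose t ht using id he
  have hd := finrank_block_eq_card σ e ht
  let dimX : Finset S → ∀ i, Fin (finrank 𝕜 (σ.block i) + 1) := fun X i =>
    ⟨(X.filter fun p => t p = i).card, by
      rw [hd i]
      exact Nat.lt_succ_of_le
        (Finset.card_le_card (Finset.filter_subset_filter _ (Finset.subset_univ _)))⟩
  -- Group the subsets by split dimension: each group has a single orbit measure, and its
  -- cardinality is the product of binomial coefficients.
  rw [nu, ← Finset.sum_fiberwise (s := Finset.univ) (g := dimX)]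
  refine Finset.sum_congr (by congr) fun n _ => ?_
  have h1 : ∀ X ∈ Finset.univ.filter (fun X => dimX X = n),
      (spanGr σ e he X).orbitMeasure = (stdPoint σ n).orbitMeasure := by
    intro X hX
    refine Gr.orbitMeasure_eq fun i => ?_
    rw [finrank_stdPoint_inf_block, ← (Finset.mem_filter.1 hX).2]
    exact finrank_span_inf_block σ e ht X i
  rw [Finset.sum_congr rfl h1, Finset.sum_const, nuStratum, ← Nat.cast_smul_eq_nsmul ℝ≥0∞]
  have h2 : (Finset.univ.filter fun X => dimX X = n).card =
      ∏ i, (finrank 𝕜 (σ.block i)).choose (n i) := by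
    simp_rw [hd]
    rw [← card_filter_card_fiber_eq t fun i => n i]
    congr 1
    ext X
    simp [dimX, funext_iff, Fin.ext_iff]
  rw [h2]
  rfl

end Orbits

/-! ### Naturality of the invariant measures -/

section Transport

variable {𝕜 E F ι : Type*} [RCLike 𝕜] [NormedAddCommGroup E] [InnerProductSpace 𝕜 E]
  [NormedAddCommGroup F] [InnerProductSpace 𝕜 F]

/-- The isomorphism of stabilisers induced by an isometry between two split spaces. -/
def Splitting.stabConj {σ : Splitting 𝕜 E ι} {τ : Splitting 𝕜 F ι} (w : E ≃ₗᵢ[𝕜] F)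
    (h : ∀ i, (σ.block i).map (w.toLinearEquiv : E →ₗ[𝕜] F) = τ.block i) :
    σ.stab →* τ.stab where
  toFun u := ⟨(w.symm.trans u.1).trans w, fun i => by
    rw [← h i, ← Submodule.map_comp]
    conv_rhs => rw [← u.2 i, ← Submodule.map_comp]
    congr 1
    ext x
    exact congrArg (fun y => w (u.1 y)) (w.symm_apply_apply x)⟩
  map_one' := Subtype.ext (LinearIsometryEquiv.ext fun x => w.apply_symm_apply x)
  map_mul' u v := Subtype.ext (LinearIsometryEquiv.ext fun x =>
    congrArg (fun y => w (u.1 y)) (w.symm_apply_apply (v.1 (w.symm x))).symm)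

lemma Splitting.stabConj_surjective {σ : Splitting 𝕜 E ι} {τ : Splitting 𝕜 F ι} (w : E ≃ₗᵢ[𝕜] F)
    (h : ∀ i, (σ.block i).map (w.toLinearEquiv : E →ₗ[𝕜] F) = τ.block i) :
    Function.Surjective (stabConj w h) := by
  have h' : ∀ i, (τ.block i).map (w.symm.toLinearEquiv : F →ₗ[𝕜] E) = σ.block i := fun i => by
    rw [← h i, ← Submodule.map_comp]
    convert Submodule.map_id _
    ext x
    exact w.symm_apply_apply x
  refine fun u => ⟨stabConj w.symm h' u, Subtype.ext (LinearIsometryEquiv.ext fun x => ?_)⟩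
  change w (w.symm (u.1 (w (w.symm x)))) = u.1 x
  simp

variable [FiniteDimensional 𝕜 E] [FiniteDimensional 𝕜 F]

omit [FiniteDimensional 𝕜 E] [FiniteDimensional 𝕜 F] in
lemma Splitting.continuous_stabConj {σ : Splitting 𝕜 E ι} {τ : Splitting 𝕜 F ι}
    (w : E ≃ₗᵢ[𝕜] F) (h : ∀ i, (σ.block i).map (w.toLinearEquiv : E →ₗ[𝕜] F) = τ.block i) :
    Continuous (stabConj w h) := by
  refine Continuous.subtype_mk (isInducing_isoToEnd.continuous_iff.2 ?_) _
  exact (continuous_const (y := (w.toContinuousLinearEquiv : E →L[𝕜] F))).clm_comp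
    ((continuous_isoToEnd.comp continuous_subtype_val).clm_comp
      (continuous_const (y := (w.symm.toContinuousLinearEquiv : F →L[𝕜] E))))

namespace Gr

/-- The bijection of Grassmannians induced by an isometry between two split spaces. -/
def transport {σ : Splitting 𝕜 E ι} {τ : Splitting 𝕜 F ι} (w : E ≃ₗᵢ[𝕜] F)
    (h : ∀ i, (σ.block i).map (w.toLinearEquiv : E →ₗ[𝕜] F) = τ.block i) : Gr σ → Gr τ :=
  push w.toLinearIsometry fun i => ⟨i, (h i).le⟩

lemma continuous_transport {σ : Splitting 𝕜 E ι} {τ : Splitting 𝕜 F ι} (w : E ≃ₗᵢ[𝕜] F)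
    (h : ∀ i, (σ.block i).map (w.toLinearEquiv : E →ₗ[𝕜] F) = τ.block i) :
    Continuous (transport w h) :=
  continuous_of_toSubmodule_eq_map w.toLinearIsometry fun _ => rfl

omit [FiniteDimensional 𝕜 E] [FiniteDimensional 𝕜 F] in
lemma act_stabConj_transport {σ : Splitting 𝕜 E ι} {τ : Splitting 𝕜 F ι} (w : E ≃ₗᵢ[𝕜] F)
    (h : ∀ i, (σ.block i).map (w.toLinearEquiv : E →ₗ[𝕜] F) = τ.block i) (u : σ.stab)
    (Q : Gr σ) : act (Splitting.stabConj w h u) (transport w h Q) = transport w h (act u Q) := by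
  refine Gr.ext ?_
  change (Q.1.map _).map _ = (Q.1.map _).map _
  rw [← Submodule.map_comp, ← Submodule.map_comp]
  congr 1
  ext x
  exact congrArg (fun y => w (u.1 y)) (w.symm_apply_apply x)

lemma map_orbitMeasure_transport {σ : Splitting 𝕜 E ι} {τ : Splitting 𝕜 F ι}
    (w : E ≃ₗᵢ[𝕜] F) (h : ∀ i, (σ.block i).map (w.toLinearEquiv : E →ₗ[𝕜] F) = τ.block i)
    (Q : Gr σ) : Q.orbitMeasure.map (transport w h) = (transport w h Q).orbitMeasure := by
  have hc := Splitting.continuous_stabConj w h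
  rw [orbitMeasure, orbitMeasure,
    ← map_haarProb_of_surjective _ hc (Splitting.stabConj_surjective w h),
    Measure.map_map (continuous_transport w h).measurable (measurable_act_left Q),
    Measure.map_map (measurable_act_left _) hc.measurable]
  congr 1
  ext1 u
  exact (act_stabConj_transport w h u Q).symm

end Gr

/-- Any adapted basis computes ν, so an adapted basis e on one side and w(e) on the other match the
two sums term by term. -/
lemma map_nu_transport [Fintype ι] {σ : Splitting 𝕜 E ι} {τ : Splitting 𝕜 F ι} (w : E ≃ₗᵢ[𝕜] F)
    (h : ∀ i, (σ.block i).map (w.toLinearEquiv : E →ₗ[𝕜] F) = τ.block i) :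
    (nu σ).map (Gr.transport w h) = nu τ := by
  let e := aggregate σ fun i => stdOrthonormalBasis 𝕜 (σ.block i)
  have he : ∀ p, ∃ i, e p ∈ σ.block i := fun p => ⟨p.1, aggregate_mem σ _ p⟩
  have he' : ∀ p, ∃ i, e.map w p ∈ τ.block i := fun p => ⟨p.1, by
    rw [← h, e.map_apply]
    exact Submodule.mem_map_of_mem (aggregate_mem σ _ p)⟩
  rw [nu_eq_sum_orbitMeasure σ e he, nu_eq_sum_orbitMeasure τ (e.map w) he',
    Measure.map_finset_sum (Gr.continuous_transport w h).measurable.aemeasurable]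
  refine Finset.sum_congr rfl fun X _ => ?_
  rw [Gr.map_orbitMeasure_transport]
  congr 1
  refine Gr.ext ?_
  change (Submodule.span 𝕜 (e '' X)).map _ = Submodule.span 𝕜 (e.map w '' X)
  rw [Submodule.map_span, Set.image_image]
  rfl

instance [Fintype ι] (σ : Splitting 𝕜 E ι) : IsFiniteMeasure (nu σ) := by
  let e := aggregate σ fun i => stdOrthonormalBasis 𝕜 (σ.block i)
  rw [nu_eq_sum_orbitMeasure σ e fun p => ⟨p.1, aggregate_mem σ _ p⟩]
  infer_instance

end Transport

/-! ### The incidence kernel -/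

section IncidenceKernel

variable {𝕜 E ι : Type*} [RCLike 𝕜] [NormedAddCommGroup E] [InnerProductSpace 𝕜 E]
  [FiniteDimensional 𝕜 E] [Fintype ι] {σ : Splitting 𝕜 E ι}

namespace Gr

/-- The invariant measure on the adapted subspaces of a point of the Grassmannian. -/
def subMeasure (Q : Gr σ) : Measure (Gr σ) := (nu Q.induced).map Q.ofInduced

instance (Q : Gr σ) : IsFiniteMeasure Q.subMeasure := Measure.isFiniteMeasure_map _ _

/-- The restriction of u is an isometry of split spaces from Q to u(Q), and ν is natural under such
isometries. -/
lemma subMeasure_act (u : σ.stab) (Q : Gr σ) :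
    (act u Q).subMeasure = Q.subMeasure.map (act u) := by
  let w : Q.1 ≃ₗᵢ[𝕜] (act u Q).1 := u.1.submoduleMap Q.1
  have hw : ∀ i, (Q.induced.block i).map (w.toLinearEquiv : Q.1 →ₗ[𝕜] (act u Q).1) =
      (act u Q).induced.block i := by
    intro i
    ext ⟨y, hy⟩
    obtain ⟨x, hx, rfl⟩ := hy
    have hux : u.1 x ∈ σ.block i ↔ x ∈ σ.block i := by
      conv_lhs => rw [← u.2 i]
      exact u.1.injective.mem_set_image
    constructor
    · rintro ⟨z, hz, hzx⟩
      have : (z : E) = x := u.1.injective (congrArg Subtype.val hzx)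
      exact hux.2 (this ▸ hz)
    · intro h
      exact ⟨⟨x, hx⟩, hux.1 h, rfl⟩
  unfold subMeasure
  rw [← map_nu_transport w hw, Measure.map_map (continuous_ofInduced _).measurable
    (continuous_transport w hw).measurable, Measure.map_map (measurable_act_right u)
    (continuous_ofInduced _).measurable]
  congr 1
  ext1 R
  refine Gr.ext ?_
  change (R.1.map _).map _ = (R.1.map _).map _
  rw [← Submodule.map_comp, ← Submodule.map_comp]
  rfl

lemma exists_act_stdPoint_eq (Q : Gr σ) : ∃ n, ∃ u : σ.stab, act u (stdPoint σ n) = Q := by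
  refine ⟨fun i => ⟨finrank 𝕜 (Q.1 ⊓ σ.block i : Submodule 𝕜 E),
    Nat.lt_succ_of_le (Submodule.finrank_mono inf_le_right)⟩, exists_act_eq fun i => ?_⟩
  rw [finrank_stdPoint_inf_block]

omit [Fintype ι] in
lemma measurable_map_act (m : Measure (Gr σ)) [SFinite m] :
    Measurable fun u : σ.stab => m.map (act u) := by
  refine Measure.measurable_of_measurable_coe _ fun A hA => ?_
  have : (fun u : σ.stab => m.map (act u) A) =
      fun u => m (Prod.mk u ⁻¹' ((fun p : σ.stab × Gr σ => act p.1 p.2) ⁻¹' A)) := by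
    ext1 u
    rw [Measure.map_apply (measurable_act_right u) hA]
    rfl
  rw [this]
  exact measurable_measure_prodMk_left (measurable_act σ hA)

/-- The space carrying the invariant measure varies with Q, so measurability is checked through
equivariance on the orbits of the finitely many standard points, then descended along the surjection
(n, u) ↦ u · `stdPoint σ n`. It gives the `bind` defining `incidence` its meaning as an integral. -/
lemma measurable_subMeasure : Measurable (subMeasure (σ := σ)) := by
  have hf : Measurable fun p : (∀ i, Fin (finrank 𝕜 (σ.block i) + 1)) × σ.stab =>
      act p.2 (stdPoint σ p.1) :=
    measurable_from_prod_countable_right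
      (f := fun p : (∀ i, Fin (finrank 𝕜 (σ.block i) + 1)) × σ.stab => act p.2 (stdPoint σ p.1))
      fun n => measurable_act_left (stdPoint σ n)
  have hs : Function.Surjective fun p : (∀ i, Fin (finrank 𝕜 (σ.block i) + 1)) × σ.stab =>
      act p.2 (stdPoint σ p.1) := fun Q => by
    obtain ⟨n, u, h⟩ := exists_act_stdPoint_eq Q
    exact ⟨(n, u), h⟩
  refine (hf.measurable_comp_iff_of_surjective hs).1 ?_
  have h : ∀ n, Measurable fun u : σ.stab => (act u (stdPoint σ n)).subMeasure := fun n => by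
    simp only [subMeasure_act]
    exact measurable_map_act _
  exact measurable_from_prod_countable_right h

end Gr

lemma incidence_apply (μ : Measure (Gr σ)) {A : Set (Gr σ)} (hA : MeasurableSet A) :
    incidence μ A = ∫⁻ Q, Q.subMeasure A ∂μ :=
  Measure.bind_apply hA Gr.measurable_subMeasure.aemeasurable

end IncidenceKernel

/-! ### Extension of isometries of an adapted subspace -/

section Extend

variable {𝕜 E ι : Type*} [RCLike 𝕜] [NormedAddCommGroup E] [InnerProductSpace 𝕜 E]
  [FiniteDimensional 𝕜 E] {σ : Splitting 𝕜 E ι}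

local notation "⟪" x ", " y "⟫" => inner 𝕜 x y

namespace Gr

/-- Since Q is the orthogonal sum of its traces, its projection agrees on the block i with the
projection on Q ∩ E_i. -/
lemma starProjection_mem_block (Q : Gr σ) {i : ι} {x : E} (hx : x ∈ σ.block i) :
    Q.1.starProjection x ∈ σ.block i := by
  have h : Q.1.starProjection x = (Q.1 ⊓ σ.block i).starProjection x := by
    refine Submodule.eq_starProjection_of_mem_orthogonal
      (inf_le_left (a := Q.1) (Submodule.starProjection_apply_mem _ x)) ?_
    have h1 : (Q.1 ⊓ σ.block i).starProjection x ∈ Q.1 ⊓ σ.block i :=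
      Submodule.starProjection_apply_mem _ x
    have h2 : (⨆ i, Q.1 ⊓ σ.block i)ᗮ = Q.1ᗮ := congrArg Submodule.orthogonal Q.2.symm
    rw [← h2, ← Submodule.iInf_orthogonal, Submodule.mem_iInf]
    intro j
    by_cases hij : j = i
    · subst hij
      exact Submodule.sub_starProjection_mem_orthogonal x
    · intro y hy
      exact σ.inner_eq_zero hij hy.2 (Submodule.sub_mem _ hx h1.2)
  rw [h]
  exact (Submodule.starProjection_apply_mem (Q.1 ⊓ σ.block i) x).2

/-- The extension of an isometry of `Q` by the identity of `Qᗮ`, as a linear isometry. -/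
def extendIsometry (Q : Submodule 𝕜 E) (v : Q ≃ₗᵢ[𝕜] Q) : E →ₗᵢ[𝕜] E where
  toLinearMap := ((Q.subtypeL ∘L isoToEnd v ∘L Q.orthogonalProjectionOnto +
    (1 - Q.starProjection) : E →L[𝕜] E) : E →ₗ[𝕜] E)
  norm_map' x := by
    have h1 : ((v (Q.orthogonalProjectionOnto x) : Q) : E) ∈ Q := Subtype.coe_prop _
    have h2 : x - Q.starProjection x ∈ Qᗮ := Submodule.sub_starProjection_mem_orthogonal x
    have h3 : Q.starProjection x ∈ Q := Submodule.starProjection_apply_mem _ _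
    change ‖((v (Q.orthogonalProjectionOnto x) : Q) : E) + (x - Q.starProjection x)‖ = ‖x‖
    rw [← sq_eq_sq₀ (norm_nonneg _) (norm_nonneg _)]
    conv_rhs => rw [← add_sub_cancel (Q.starProjection x) x]
    rw [sq, sq, norm_add_sq_eq_norm_sq_add_norm_sq_of_inner_eq_zero (𝕜 := 𝕜) _ _
      (Submodule.inner_right_of_mem_orthogonal h1 h2),
      norm_add_sq_eq_norm_sq_add_norm_sq_of_inner_eq_zero (𝕜 := 𝕜) _ _
      (Submodule.inner_right_of_mem_orthogonal h3 h2)]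
    have h4 : ‖((v (Q.orthogonalProjectionOnto x) : Q) : E)‖ = ‖Q.starProjection x‖ :=
      v.norm_map _
    rw [h4]

lemma extendIsometry_apply (Q : Submodule 𝕜 E) (v : Q ≃ₗᵢ[𝕜] Q) (x : E) :
    extendIsometry Q v x = (v (Q.orthogonalProjectionOnto x) : E) + (x - Q.starProjection x) := rfl

/-- The extension of an isometry of an adapted subspace `Q` by the identity of `Qᗮ`. -/
def extend (Q : Gr σ) (v : Q.induced.stab) : σ.stab :=
  ⟨(extendIsometry Q.1 v.1).toLinearIsometryEquiv rfl, fun i => by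
    refine Submodule.eq_of_le_of_finrank_eq ?_
      (LinearEquiv.finrank_map_eq
        ((extendIsometry Q.1 v.1).toLinearIsometryEquiv rfl).toLinearEquiv _)
    rintro _ ⟨x, hx, rfl⟩
    change extendIsometry Q.1 v.1 x ∈ _
    rw [extendIsometry_apply]
    have h1 := Q.starProjection_mem_block hx
    have h2 : v.1 (Q.1.orthogonalProjectionOnto x) ∈ Q.induced.block i :=
      (v.2 i).le (Submodule.mem_map_of_mem (f := (v.1.toLinearEquiv : Q.1 →ₗ[𝕜] Q.1)) h1)
    exact Submodule.add_mem _ h2 (Submodule.sub_mem _ hx h1)⟩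

lemma extend_apply (Q : Gr σ) (v : Q.induced.stab) (x : E) :
    (Q.extend v).1 x =
      (v.1 (Q.1.orthogonalProjectionOnto x) : E) + (x - Q.1.starProjection x) := rfl

lemma extend_apply_coe (Q : Gr σ) (v : Q.induced.stab) (x : Q.1) :
    (Q.extend v).1 x = v.1 x := by
  rw [extend_apply, Submodule.orthogonalProjectionOnto_mem_subspace_eq_self,
    Submodule.starProjection_eq_self_iff.2 x.2, sub_self, add_zero]

lemma measurable_extend (Q : Gr σ) : Measurable Q.extend := by
  refine Continuous.measurable (Continuous.subtype_mk (isInducing_isoToEnd.continuous_iff.2 ?_) _)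
  have h : Continuous fun v : Q.induced.stab => Q.1.subtypeL ∘L isoToEnd v.1 ∘L
      Q.1.orthogonalProjectionOnto + (1 - Q.1.starProjection) :=
    (continuous_const.clm_comp ((continuous_isoToEnd.comp continuous_subtype_val).clm_comp
      continuous_const)).add continuous_const
  exact h

lemma act_extend_ofInduced (Q : Gr σ) (v : Q.induced.stab) (R : Gr Q.induced) :
    act (Q.extend v) (Q.ofInduced R) = Q.ofInduced (act v R) := by
  refine Gr.ext ?_
  change (R.1.map _).map _ = (R.1.map _).map _
  rw [← Submodule.map_comp, ← Submodule.map_comp]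
  congr 1
  ext x
  exact Q.extend_apply_coe v x

lemma act_extend_self (Q : Gr σ) (v : Q.induced.stab) : act (Q.extend v) Q = Q := by
  refine Gr.ext (Submodule.eq_of_le_of_finrank_eq ?_
    (LinearEquiv.finrank_map_eq (Q.extend v).1.toLinearEquiv _))
  rintro _ ⟨x, hx, rfl⟩
  change (Q.extend v).1 x ∈ _
  rw [Q.extend_apply_coe v ⟨x, hx⟩]
  exact Subtype.coe_prop _

end Gr

/-- The orthonormal basis of the span of some of the vectors of an orthonormal basis. -/
def spanBasis {S : Type*} [Fintype S] (e : OrthonormalBasis S 𝕜 E) (X : Finset S) :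
    OrthonormalBasis X 𝕜 (Submodule.span 𝕜 (e '' X)) :=
  OrthonormalBasis.mk (v := fun p => ⟨e p, Submodule.subset_span ⟨p, p.2, rfl⟩⟩)
    ((e.orthonormal.comp (Subtype.val : X → S) Subtype.val_injective).codRestrict _ _)
    (by
      rintro ⟨x, hx⟩ -
      have h : (Submodule.span 𝕜 (Set.range fun p : X => (⟨e p, Submodule.subset_span
          ⟨p, p.2, rfl⟩⟩ : Submodule.span 𝕜 (e '' X)))).map (Submodule.subtype _) =
          Submodule.span 𝕜 (e '' X) := by
        rw [Submodule.map_span, ← Set.range_comp]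
        congr 1
        ext y
        simp
      have h2 := h.ge hx
      obtain ⟨y, hy, hyx⟩ := h2
      have : y = ⟨x, hx⟩ := Subtype.ext hyx
      exact this ▸ hy)

omit [FiniteDimensional 𝕜 E] in
lemma spanBasis_apply {S : Type*} [Fintype S] (e : OrthonormalBasis S 𝕜 E) (X : Finset S) (p : X) :
    (spanBasis e X p : E) = e p :=
  congrArg Subtype.val (congrFun (OrthonormalBasis.coe_mk _ _) p)

omit [FiniteDimensional 𝕜 E] in
lemma spanBasis_mem {S : Type*} [Fintype S] (e : OrthonormalBasis S 𝕜 E)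
    (he : ∀ p, ∃ i, e p ∈ σ.block i) (X : Finset S) (p : X) :
    ∃ i, spanBasis e X p ∈ (spanGr σ e he X).induced.block i := by
  obtain ⟨i, hi⟩ := he p
  refine ⟨i, ?_⟩
  change ((spanBasis e X p : Submodule.span 𝕜 (e '' X)) : E) ∈ σ.block i
  rwa [spanBasis_apply]

omit [FiniteDimensional 𝕜 E] in
lemma ofInduced_spanGr {S : Type*} [Fintype S] (e : OrthonormalBasis S 𝕜 E)
    (he : ∀ p, ∃ i, e p ∈ σ.block i) (X : Finset S) (Y : Finset X) :
    (spanGr σ e he X).ofInduced (spanGr _ (spanBasis e X) (spanBasis_mem e he X) Y) =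
      spanGr σ e he (Y.map (Function.Embedding.subtype _)) := by
  refine Gr.ext ?_
  change (Submodule.span 𝕜 (spanBasis e X '' Y)).map (Submodule.subtype _) = Submodule.span 𝕜 _
  rw [Submodule.map_span, Set.image_image, Finset.coe_map, Set.image_image]
  simp only [Submodule.subtype_apply, spanBasis_apply]
  rfl

/-- The vectors of e labelled by X form an adapted basis of Q; extending isometries of Q to E
expresses its orbits through the ambient action. -/
lemma subMeasure_spanGr [Fintype ι] {S : Type*} [Fintype S] (e : OrthonormalBasis S 𝕜 E)
    (he : ∀ p, ∃ i, e p ∈ σ.block i) (X : Finset S) :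
    (spanGr σ e he X).subMeasure = ∑ Y : Finset X,
      (haarProb (spanGr σ e he X).induced.stab).map fun v =>
        Gr.act ((spanGr σ e he X).extend v)
          (spanGr σ e he (Y.map (Function.Embedding.subtype _))) := by
  rw [Gr.subMeasure, nu_eq_sum_orbitMeasure (spanGr σ e he X).induced (spanBasis e X) (spanBasis_mem e he X),
    Measure.map_finset_sum (Gr.continuous_ofInduced _).measurable.aemeasurable]
  refine Finset.sum_congr rfl fun Y _ => ?_
  rw [Gr.orbitMeasure, Measure.map_map (Gr.continuous_ofInduced _).measurable
    (Gr.measurable_act_left _)]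
  congr 1
  ext1 v
  rw [Function.comp_apply, ← Gr.act_extend_ofInduced, ofInduced_spanGr]

-- A basis adapted to the refined splitting contains bases of all the traces Q ∩ E_i.
open scoped Classical in
lemma Gr.exists_eq_spanGr [Fintype ι] (Q : Gr σ) : ∃ (e : OrthonormalBasis (Labels Q.refine) 𝕜 E)
    (he : ∀ p, ∃ i, e p ∈ σ.block i) (X : Finset (Labels Q.refine)), Q = spanGr σ e he X := by
  let e := aggregate Q.refine fun j => stdOrthonormalBasis 𝕜 (Q.refine.block j)
  have hle : ∀ j, Q.refine.block j ≤ σ.block j.1 := by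
    rintro ⟨i, a⟩
    cases a <;> exact inf_le_right
  refine ⟨e, fun p => ⟨p.1.1, hle _ (aggregate_mem _ _ p)⟩,
    Finset.univ.filter fun p => p.1.2 = true, Gr.ext (le_antisymm ?_ ?_)⟩
  · conv_lhs => rw [Q.2]
    refine iSup_le fun i x hx => ?_
    refine (mem_span_image_iff_inner e _ x).2 fun p hp => ?_
    refine (Q.refine.mem_block_iff e (t := Sigma.fst) (aggregate_mem _ _) (i, true) x).1 hx p ?_
    intro h
    simp [h] at hp
  · refine Submodule.span_le.2 ?_
    rintro _ ⟨p, hp, rfl⟩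
    have h1 : p.1.2 = true := by simpa using hp
    have h2 := aggregate_mem Q.refine (fun j => stdOrthonormalBasis 𝕜 (Q.refine.block j)) p
    simp only [Gr.refine, h1, if_true] at h2
    exact h2.1

end Extend

/-! ### Injectivity of the incidence transform -/

section Uniqueness

variable {𝕜 E ι : Type*} [RCLike 𝕜] [NormedAddCommGroup E] [InnerProductSpace 𝕜 E]
  [FiniteDimensional 𝕜 E] [Fintype ι] {σ : Splitting 𝕜 E ι}

/-- A proper subset Y of X yields dimension less than dim Q ≤ r, hence never a point of A; the
remaining term Y = X is the unit mass at Q, since extended isometries fix Q. -/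
lemma subMeasure_spanGr_apply_of_finrank_le {S : Type*} [Fintype S] (e : OrthonormalBasis S 𝕜 E)
    (he : ∀ p, ∃ i, e p ∈ σ.block i) (X : Finset S) {r : ℕ} {A : Set (Gr σ)}
    (hA : MeasurableSet A) (hr : ∀ R ∈ A, finrank 𝕜 R.1 = r)
    (hQ : finrank 𝕜 (spanGr σ e he X).1 ≤ r) :
    (spanGr σ e he X).subMeasure A = A.indicator 1 (spanGr σ e he X) := by
  classical
  set Q := spanGr σ e he X
  have hcard : ∀ Z : Finset S, finrank 𝕜 (spanGr σ e he Z).1 = Z.card := fun Z => by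
    change finrank 𝕜 (Submodule.span 𝕜 (e '' Z)) = _
    rw [← Finset.coe_image, finrank_span_finset_eq_card,
      Finset.card_image_of_injective _ e.orthonormal.linearIndependent.injective]
    rw [Finset.coe_image]
    exact (e.orthonormal.linearIndependent.linearIndepOn _).id_image
  have hm : ∀ Y : Finset X, Measurable fun v => Gr.act (Q.extend v)
      (spanGr σ e he (Y.map (Function.Embedding.subtype _))) := fun Y =>
    (Gr.measurable_act_left _).comp Q.measurable_extend
  rw [subMeasure_spanGr, Measure.finsetSum_apply, Finset.sum_eq_single Finset.univ]
  · rw [Measure.map_apply (hm _) hA]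
    have h1 : (Finset.univ : Finset X).map (Function.Embedding.subtype _) = X := by
      ext; simp
    simp only [h1]
    have h2 : ∀ v, Gr.act (Q.extend v) (spanGr σ e he X) = Q := Q.act_extend_self
    simp only [h2]
    by_cases hQA : Q ∈ A
    · simp [hQA]
    · simp [hQA]
  · intro Y _ hY
    rw [Measure.map_apply (hm _) hA]
    convert measure_empty
    · ext v
      simp only [Set.mem_preimage, Set.mem_empty_iff_false, iff_false]
      intro hv
      have h1 := hr _ hv
      have h2 : finrank 𝕜 (Gr.act (Q.extend v)
          (spanGr σ e he (Y.map (Function.Embedding.subtype _)))).1 = Y.card := by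
        refine (LinearEquiv.finrank_map_eq (Q.extend v).1.toLinearEquiv _).trans ?_
        rw [hcard, Finset.card_map]
      have h3 : Y.card < X.card := by
        have := (Finset.card_lt_iff_ne_univ Y).2 hY
        rwa [Fintype.card_coe] at this
      have h4 := hcard X
      change finrank 𝕜 Q.1 = _ at h4
      omega
    · infer_instance
  · simp

lemma Gr.subMeasure_apply_of_finrank_le {r : ℕ} {A : Set (Gr σ)} (hA : MeasurableSet A)
    (hr : ∀ R ∈ A, finrank 𝕜 R.1 = r) (Q : Gr σ) (hQ : finrank 𝕜 Q.1 ≤ r) :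
    Q.subMeasure A = A.indicator 1 Q := by
  obtain ⟨e, he, X, h⟩ := Q.exists_eq_spanGr
  rw [h] at hQ ⊢
  exact subMeasure_spanGr_apply_of_finrank_le e he X hA hr hQ

/-- Each subset of a basis of Q contributes one unit of mass. -/
lemma Gr.subMeasure_univ_le (Q : Gr σ) : Q.subMeasure Set.univ ≤ 2 ^ finrank 𝕜 E := by
  classical
  obtain ⟨e, he, X, h⟩ := Q.exists_eq_spanGr
  have hm : ∀ Y : Finset X, Measurable fun v => Gr.act ((spanGr σ e he X).extend v)
      (spanGr σ e he (Y.map (Function.Embedding.subtype _))) := fun Y =>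
    (Gr.measurable_act_left _).comp (spanGr σ e he X).measurable_extend
  have h1 : (spanGr σ e he X).subMeasure Set.univ = 2 ^ X.card := by
    rw [subMeasure_spanGr, Measure.finsetSum_apply, Finset.sum_congr rfl (g := fun _ => 1)
      fun Y _ => by rw [Measure.map_apply (hm Y) .univ, Set.preimage_univ, measure_univ]]
    simp
  rw [h, h1, finrank_eq_card_basis e.toBasis]
  exact pow_le_pow_right₀ one_le_two (Finset.card_le_univ X)

instance isFiniteMeasure_incidence (μ : Measure (Gr σ)) [IsFiniteMeasure μ] :
    IsFiniteMeasure (incidence μ) := by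
  refine ⟨?_⟩
  rw [incidence_apply μ .univ]
  calc ∫⁻ Q, Q.subMeasure Set.univ ∂μ ≤ ∫⁻ _, 2 ^ finrank 𝕜 E ∂μ :=
        lintegral_mono Gr.subMeasure_univ_le
    _ < ⊤ := by
        rw [lintegral_const]
        exact ENNReal.mul_lt_top (ENNReal.pow_lt_top ENNReal.ofNat_lt_top) (measure_lt_top μ _)

/-- Descending induction on dimension: once the measures agree above dimension r, the incidence
measure in dimension r differs from the measure itself only by a contribution already known. -/
lemma incidence_injective {μ μ' : Measure (Gr σ)} [IsFiniteMeasure μ] [IsFiniteMeasure μ']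
    (h : incidence μ = incidence μ') : μ = μ' := by
  -- Equality on sets of subspaces of dimension at least r, by induction on a bound d for the number
  -- of dimensions from r to dim E; for d = 0 such sets are empty.
  have hr : ∀ d r, finrank 𝕜 E < r + d → ∀ A : Set (Gr σ), MeasurableSet A →
      (∀ R ∈ A, r ≤ finrank 𝕜 R.1) → μ A = μ' A := by
    intro d
    induction d with
    | zero =>
      intro r hd A _ hA
      have : A = ∅ := Set.eq_empty_of_forall_notMem fun R hR => by
        have := hA R hR
        have := Submodule.finrank_le R.1
        omega
      rw [this, measure_empty, measure_empty]
    | succ d ih =>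
      intro r hd A hmA hA
      set B : Set (Gr σ) := {R | finrank 𝕜 R.1 = r}
      have hB : MeasurableSet B := measurableSet_finrank_eq σ r
      set C : Set (Gr σ) := {R | r < finrank 𝕜 R.1}
      have hC : MeasurableSet C := by
        have : C = ⋃ s ∈ Set.Ioi r, {R : Gr σ | finrank 𝕜 R.1 = s} := by
          ext R; simp [C]
        rw [this]
        exact MeasurableSet.biUnion (Set.to_countable _) fun s _ => measurableSet_finrank_eq σ s
      have hCres : μ.restrict C = μ'.restrict C := by
        ext D hD
        rw [Measure.restrict_apply hD, Measure.restrict_apply hD]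
        exact ih (r + 1) (by omega) _ (hD.inter hC) fun R hR => hR.2
      -- In dimension exactly r, subspaces of dimension at most r contribute only themselves; all
      -- other contributions come from C.
      have key : ∀ ρ : Measure (Gr σ),
          incidence ρ (A ∩ B) = ρ (A ∩ B) + ∫⁻ Q in C, Q.subMeasure (A ∩ B) ∂ρ := by
        intro ρ
        have hAB := hmA.inter hB
        rw [incidence_apply ρ hAB, ← lintegral_add_compl _ hC, add_comm]
        congr 1
        rw [setLIntegral_congr_fun (g := (A ∩ B).indicator 1) hC.compl fun Q hQ =>
          Gr.subMeasure_apply_of_finrank_le hAB (fun R hR => hR.2) Q (not_lt.1 hQ),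
          lintegral_indicator_one hAB, Measure.restrict_apply hAB]
        congr 1
        ext Q
        simp only [Set.mem_inter_iff, Set.mem_compl_iff, B, C, Set.mem_ofPred_eq]
        constructor
        · exact fun h => h.1
        · exact fun h => ⟨h, by omega⟩
      have e1 := key μ
      have e2 := key μ'
      rw [← h, ← hCres, e1] at e2
      -- Cancelling the common term in `ℝ≥0∞` requires it to be finite.
      have hne : ∫⁻ Q in C, Q.subMeasure (A ∩ B) ∂μ ≠ ⊤ := by
        have := measure_ne_top (incidence μ) (A ∩ B)
        rw [e1] at this
        exact (ENNReal.add_ne_top.1 this).2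
      have h1 : μ (A ∩ B) = μ' (A ∩ B) := (ENNReal.add_left_inj hne).1 e2
      have h2 : μ (A \ B) = μ' (A \ B) := ih (r + 1) (by omega) _ (hmA.diff hB) fun R hR => by
        have := hA R hR.1
        have h3 : finrank 𝕜 R.1 ≠ r := hR.2
        omega
      rw [← measure_inter_add_sdiff A hB, ← measure_inter_add_sdiff (μ := μ') A hB, h1, h2]
  ext A hA
  exact hr (finrank 𝕜 E + 1) 0 (by omega) A hA fun R _ => Nat.zero_le _

end Uniqueness

/-! ### The density of a determinantal linear process -/

section Density

variable {𝕜 E ι : Type*} [RCLike 𝕜] [NormedAddCommGroup E] [InnerProductSpace 𝕜 E]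
  [FiniteDimensional 𝕜 E]

/-- The density of a determinantal linear process with respect to the invariant measure. -/
def weight (k : E →ₗ[𝕜] E) (Q : Submodule 𝕜 E) : ℝ≥0 :=
  (RCLike.re (mixedDet k (1 - k) Q)).toNNReal

/-- The density of the incidence measure of a determinantal linear process. -/
def correlation (k : E →ₗ[𝕜] E) (Q : Submodule 𝕜 E) : ℝ≥0 :=
  (RCLike.re (mixedDet k 1 Q)).toNNReal

lemma measurable_weight {ι : Type*} (σ : Splitting 𝕜 E ι) (k : E →ₗ[𝕜] E) :
    Measurable fun Q : Gr σ => weight k Q.1 :=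
  (RCLike.continuous_re.measurable.comp (measurable_mixedDet σ k (1 - k))).real_toNNReal

lemma measurable_correlation {ι : Type*} (σ : Splitting 𝕜 E ι) (k : E →ₗ[𝕜] E) :
    Measurable fun Q : Gr σ => correlation k Q.1 :=
  (RCLike.continuous_re.measurable.comp (measurable_mixedDet σ k 1)).real_toNNReal

lemma IsKernel.coe_weight {k : E →ₗ[𝕜] E} (hk : IsKernel k) (Q : Submodule 𝕜 E) :
    ((weight k Q : ℝ) : 𝕜) = mixedDet k (1 - k) Q := by
  obtain ⟨r, hr, h⟩ := hk.mixedDet_nonneg Q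
  rw [weight, ← h, RCLike.ofReal_re, Real.coe_toNNReal _ hr]

open scoped Classical in
lemma IsKernel.sum_weight {k : E →ₗ[𝕜] E} (hk : IsKernel k) {S : Type*} [Fintype S]
    (e : OrthonormalBasis S 𝕜 E) (J : Finset S) :
    ∑ X : Finset S with J ⊆ X, weight k (Submodule.span 𝕜 (e '' X)) =
      correlation k (Submodule.span 𝕜 (e '' J)) := by
  rw [correlation, ← sum_mixedDet_span_image]
  simp_rw [← hk.coe_weight]
  rw [map_sum]
  simp only [RCLike.ofReal_re]
  rw [← NNReal.coe_sum, Real.toNNReal_coe]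

/-- Nonnegativity is inherited from the weights, of which this determinant is a sum. -/
lemma IsKernel.coe_correlation {k : E →ₗ[𝕜] E} (hk : IsKernel k) (Q : Submodule 𝕜 E) :
    ((correlation k Q : ℝ) : 𝕜) = mixedDet k 1 Q := by
  classical
  -- With a single block every subspace is adapted, so Q is spanned by part of an orthonormal basis.
  let τ : Splitting 𝕜 E Unit := ⟨fun _ => ⊤, fun _ _ h => (h rfl).elim, by simp⟩
  have hτ : τ.IsAdapted Q := by simp [Splitting.IsAdapted, τ]
  obtain ⟨e, he, X, h⟩ := Gr.exists_eq_spanGr (⟨Q, hτ⟩ : Gr τ)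
  have hQ : Q = Submodule.span 𝕜 (e '' X) := congrArg Gr.toSubmodule h
  rw [hQ, ← hk.sum_weight e X, ← sum_mixedDet_span_image, NNReal.coe_sum, RCLike.ofReal_sum]
  exact Finset.sum_congr rfl fun X _ => hk.coe_weight _

/-- The determinantal linear process, given by its density. -/
def dlpMeasure [Fintype ι] (σ : Splitting 𝕜 E ι) (k : E →ₗ[𝕜] E) : Measure (Gr σ) :=
  (nu σ).withDensity fun Q => weight k Q.1

variable [Fintype ι] {σ : Splitting 𝕜 E ι}

lemma lintegral_nu {S : Type*} [Fintype S] (e : OrthonormalBasis S 𝕜 E)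
    (he : ∀ p, ∃ i, e p ∈ σ.block i) {f : Gr σ → ℝ≥0∞} (hf : Measurable f) :
    ∫⁻ Q, f Q ∂(nu σ) =
      ∑ X : Finset S, ∫⁻ u : σ.stab, f (Gr.act u (spanGr σ e he X)) ∂(haarProb σ.stab) := by
  rw [nu_eq_sum_orbitMeasure σ e he, lintegral_finsetSum_measure]
  exact Finset.sum_congr rfl fun X _ => lintegral_map hf (Gr.measurable_act_left _)

omit [FiniteDimensional 𝕜 E] [Fintype ι] in
lemma act_spanGr_toSubmodule {S : Type*} [Fintype S] (e : OrthonormalBasis S 𝕜 E)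
    (he : ∀ p, ∃ i, e p ∈ σ.block i) (u : σ.stab) (X : Finset S) :
    (Gr.act u (spanGr σ e he X)).1 = Submodule.span 𝕜 (e.map u.1 '' X) := by
  change (Submodule.span 𝕜 (e '' X)).map _ = _
  rw [Submodule.map_span, Set.image_image]
  rfl

open scoped Classical in
omit [Fintype ι] in
lemma IsKernel.sum_weight_act {k : E →ₗ[𝕜] E} (hk : IsKernel k) {S : Type*} [Fintype S]
    (e : OrthonormalBasis S 𝕜 E) (he : ∀ p, ∃ i, e p ∈ σ.block i) (u : σ.stab) (J : Finset S) :
    ∑ X : Finset S with J ⊆ X, weight k (Gr.act u (spanGr σ e he X)).1 =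
      correlation k (Gr.act u (spanGr σ e he J)).1 := by
  simp only [act_spanGr_toSubmodule]
  exact hk.sum_weight (e.map u.1) J

/-- Averaging over the group absorbs a random right translation. -/
lemma lintegral_lintegral_haarProb_mul {G Ω : Type*} [Group G] [TopologicalSpace G]
    [IsTopologicalGroup G] [CompactSpace G] [MeasurableSpace G] [BorelSpace G] [MeasurableMul₂ G]
    [MeasurableSpace Ω] (P : Measure Ω) [IsProbabilityMeasure P] {g : Ω → G} (hg : Measurable g)
    {f : G → ℝ≥0∞} (hf : Measurable f) :
    ∫⁻ u, ∫⁻ ω, f (u * g ω) ∂P ∂(haarProb G) = ∫⁻ u, f u ∂(haarProb G) := by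
  rw [lintegral_lintegral_swap]
  · simp only [lintegral_mul_right_eq_self]
    simp
  · exact (hf.comp (measurable_fst.mul (hg.comp measurable_snd))).aemeasurable

/-- Since the extension of v fixes Q, the weight of u(Q) can be evaluated at u · (extension of v),
as can the random subspace; the integrand then depends on this product alone, and averaging over u
removes v. -/
lemma lintegral_weight_mul_subMeasure (k : E →ₗ[𝕜] E) {S : Type*} [Fintype S]
    (e : OrthonormalBasis S 𝕜 E) (he : ∀ p, ∃ i, e p ∈ σ.block i) (X : Finset S)
    {A : Set (Gr σ)} (hA : MeasurableSet A) :
    ∫⁻ u : σ.stab, weight k (Gr.act u (spanGr σ e he X)).1 *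
        (Gr.act u (spanGr σ e he X)).subMeasure A ∂(haarProb σ.stab) =
      ∑ Y : Finset X, ∫⁻ u : σ.stab, weight k (Gr.act u (spanGr σ e he X)).1 *
        A.indicator 1 (Gr.act u (spanGr σ e he (Y.map (Function.Embedding.subtype _))))
          ∂(haarProb σ.stab) := by
  set Q := spanGr σ e he X
  let R : Finset X → Gr σ := fun Y => spanGr σ e he (Y.map (Function.Embedding.subtype _))
  let Φ : Finset X → σ.stab → ℝ≥0∞ := fun Y u =>
    weight k (Gr.act u Q).1 * A.indicator 1 (Gr.act u (R Y))
  have hΦ : ∀ Y, Measurable (Φ Y) := fun Y =>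
    ((measurable_weight σ k).coe_nnreal_ennreal.comp (Gr.measurable_act_left Q)).mul
      ((measurable_one.indicator hA).comp (Gr.measurable_act_left (R Y)))
  have h1 : ∀ u : σ.stab, weight k (Gr.act u Q).1 * (Gr.act u Q).subMeasure A =
      ∑ Y : Finset X, ∫⁻ v, Φ Y (u * Q.extend v) ∂(haarProb Q.induced.stab) := by
    intro u
    have hu : MeasurableSet (Gr.act u ⁻¹' A) := Gr.measurable_act_right u hA
    rw [Gr.subMeasure_act, Measure.map_apply (Gr.measurable_act_right u) hA, subMeasure_spanGr,
      Measure.finsetSum_apply, Finset.mul_sum]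
    refine Finset.sum_congr rfl fun Y _ => ?_
    have hm : Measurable fun v => Gr.act (Q.extend v) (R Y) :=
      (Gr.measurable_act_left _).comp Q.measurable_extend
    simp only [Φ, Gr.act_mul, Gr.act_extend_self]
    rw [lintegral_const_mul]
    · congr 1
      rw [Measure.map_apply hm hu, ← lintegral_indicator_one (hm hu)]
      rfl
    · exact (measurable_one.indicator hA).comp ((Gr.measurable_act_right u).comp hm)
  simp_rw [h1]
  rw [lintegral_finsetSum]
  · exact Finset.sum_congr rfl fun Y _ =>
      lintegral_lintegral_haarProb_mul _ Q.measurable_extend (hΦ Y)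
  · exact fun Y _ => Measurable.lintegral_prod_right'
      (f := fun p : σ.stab × Q.induced.stab => Φ Y (p.1 * Q.extend p.2))
      ((hΦ Y).comp (measurable_fst.mul (Q.measurable_extend.comp measurable_snd)))

/-- After v has been removed, exchange the sums over Y ⊆ X: for each fixed u, the weights of the X
containing Y add up to the determinant attached to Y in the basis u(e). -/
lemma IsKernel.incidence_dlpMeasure {k : E →ₗ[𝕜] E} (hk : IsKernel k) :
    incidence (dlpMeasure σ k) = (nu σ).withDensity fun Q => correlation k Q.1 := by
  classical
  let e := aggregate σ fun i => stdOrthonormalBasis 𝕜 (σ.block i)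
  have he : ∀ p, ∃ i, e p ∈ σ.block i := fun p => ⟨p.1, aggregate_mem σ _ p⟩
  have hw := (measurable_weight σ k).coe_nnreal_ennreal
  have hc := (measurable_correlation σ k).coe_nnreal_ennreal
  ext A hA
  have hsub : Measurable fun Q : Gr σ => Q.subMeasure A :=
    (Measure.measurable_coe hA).comp Gr.measurable_subMeasure
  have hind : Measurable (A.indicator (1 : Gr σ → ℝ≥0∞)) := measurable_one.indicator hA
  rw [incidence_apply _ hA, dlpMeasure, lintegral_withDensity_eq_lintegral_mul _ hw hsub,
    withDensity_apply _ hA, ← lintegral_indicator hA]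
  simp only [Pi.mul_apply]
  have hws : Measurable fun Q : Gr σ => (weight k Q.1 : ℝ≥0∞) * Q.subMeasure A := hw.mul hsub
  rw [lintegral_nu e he hws, lintegral_nu e he (hc.indicator hA)]
  simp_rw [lintegral_weight_mul_subMeasure k e he _ hA]
  -- Subsets of the subtype X become subsets of the label set contained in X, so that the two sums
  -- can be exchanged.
  have h1 : ∀ X : Finset (Labels σ), ∑ Y : Finset X, ∫⁻ u : σ.stab,
      weight k (Gr.act u (spanGr σ e he X)).1 *
        A.indicator 1 (Gr.act u (spanGr σ e he (Y.map (Function.Embedding.subtype _))))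
          ∂(haarProb σ.stab) =
      ∑ Y : Finset (Labels σ), if Y ⊆ X then ∫⁻ u : σ.stab,
        weight k (Gr.act u (spanGr σ e he X)).1 *
          A.indicator 1 (Gr.act u (spanGr σ e he Y)) ∂(haarProb σ.stab) else 0 := by
    intro X
    rw [← Finset.sum_filter]
    refine Finset.sum_nbij' (fun Y => Y.map (Function.Embedding.subtype _))
      (fun Y => Y.subtype (· ∈ X)) ?_ ?_ ?_ ?_ ?_
    · intro Y _
      simp only [Finset.mem_filter, Finset.mem_univ, true_and]
      intro p hp
      obtain ⟨q, _, rfl⟩ := Finset.mem_map.1 hp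
      exact q.2
    · simp
    · intro Y _
      ext p
      simp
    · intro Y hY
      simp only [Finset.mem_filter, Finset.mem_univ, true_and] at hY
      ext p
      simpa using fun hp => hY hp
    · exact fun _ _ => rfl
  simp_rw [h1]
  rw [Finset.sum_comm]
  refine Finset.sum_congr rfl fun Y _ => ?_
  rw [← Finset.sum_filter, ← lintegral_finsetSum]
  · refine lintegral_congr fun u => ?_
    have h2 : ∑ X : Finset (Labels σ) with Y ⊆ X, weight k (Gr.act u (spanGr σ e he X)).1 =
        correlation k (Gr.act u (spanGr σ e he Y)).1 := by
      convert hk.sum_weight_act e he u Y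
    rw [← Finset.sum_mul, Set.indicator_apply, Set.indicator_apply,
      ← ENNReal.ofNNReal_finsetSum, h2]
    split_ifs <;> simp
  · exact fun X _ => (hw.comp (Gr.measurable_act_left _)).mul
      (hind.comp (Gr.measurable_act_left _))

/-- The case J = ∅ of the finite identity: for each u the weights sum to det 1 = 1. -/
lemma IsKernel.isProbabilityMeasure_dlpMeasure {k : E →ₗ[𝕜] E} (hk : IsKernel k) :
    IsProbabilityMeasure (dlpMeasure σ k) := by
  classical
  let e := aggregate σ fun i => stdOrthonormalBasis 𝕜 (σ.block i)
  have he : ∀ p, ∃ i, e p ∈ σ.block i := fun p => ⟨p.1, aggregate_mem σ _ p⟩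
  have hw := (measurable_weight σ k).coe_nnreal_ennreal
  have hX : ∀ X : Finset (Labels σ), Measurable fun u : σ.stab =>
      (weight k (Gr.act u (spanGr σ e he X)).1 : ℝ≥0∞) :=
    fun X => hw.comp (Gr.measurable_act_left _)
  refine ⟨?_⟩
  rw [dlpMeasure, withDensity_apply _ .univ, setLIntegral_univ, lintegral_nu e he hw,
    ← lintegral_finsetSum _ fun X _ => hX X]
  have h : ∀ u : σ.stab, ∑ X : Finset (Labels σ),
      (weight k (Gr.act u (spanGr σ e he X)).1 : ℝ≥0∞) = 1 := by
    intro u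
    have h1 := hk.sum_weight_act e he u ∅
    simp only [Finset.empty_subset, Finset.filter_true] at h1
    rw [← ENNReal.ofNNReal_finsetSum, h1]
    have h2 : (Gr.act u (spanGr σ e he ∅)).1 = ⊥ := by
      rw [act_spanGr_toSubmodule]
      simp
    rw [h2, correlation, mixedDet]
    simp
  simp [h]

lemma IsKernel.isDLP_iff {k : E →ₗ[𝕜] E} (hk : IsKernel k) (μ : Measure (Gr σ)) :
    IsDLP σ k μ ↔ μ = dlpMeasure σ k := by
  have := hk.isProbabilityMeasure_dlpMeasure (σ := σ)
  constructor
  · rintro ⟨hμ, f, -, hf, h⟩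
    refine incidence_injective ?_
    rw [h, hk.incidence_dlpMeasure]
    congr 1
    ext1 Q
    have h1 : ((f Q : ℝ) : 𝕜) = ((correlation k Q.1 : ℝ) : 𝕜) := by
      rw [hf, hk.coe_correlation, mixedDet_one_eq_det_compression]
    rw [NNReal.coe_injective (RCLike.ofReal_injective h1)]
  · rintro rfl
    exact ⟨this, fun Q => correlation k Q.1, measurable_correlation σ k, fun Q => by
      rw [hk.coe_correlation, mixedDet_one_eq_det_compression], hk.incidence_dlpMeasure⟩

lemma IsKernel.dlp_eq {k : E →ₗ[𝕜] E} (hk : IsKernel k) : dlp σ k = dlpMeasure σ k := by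
  have h : ∃ μ, IsDLP σ k μ := ⟨_, (hk.isDLP_iff _).2 rfl⟩
  rw [dlp, dif_pos h]
  exact (hk.isDLP_iff _).1 h.choose_spec

end Density

/-! ### Determinantal point processes -/

section PointProcesses

variable {𝕜 E : Type*} [RCLike 𝕜] [NormedAddCommGroup E] [InnerProductSpace 𝕜 E]
  [FiniteDimensional 𝕜 E]

/-- A probability measure on the set of finite sets is determined by the inclusion probabilities. -/
lemma measure_finset_ext {S : Type*} [Finite S] {ρ ρ' : Measure (Finset S)}
    [IsProbabilityMeasure ρ] [IsProbabilityMeasure ρ']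
    (h : ∀ J : Finset S, ρ {X | J ⊆ X} = ρ' {X | J ⊆ X}) : ρ = ρ' := by
  classical
  have hms : ∀ J : Finset S, MeasurableSet {X : Finset S | J ⊆ X} := fun J => by
    have : {X : Finset S | J ⊆ X} = ⋂ a ∈ J, {X | a ∈ X} := by
      ext X; simp [Finset.subset_iff]
    rw [this]
    exact J.measurableSet_biInter fun a _ => measurableSet_setOfPred.2 (measurable_finset_mem a)
  -- The events {J ⊆ X} form a π-system, intersections corresponding to unions of the sets J, and
  -- singletons J already generate.
  refine ext_of_generate_finite (Set.range fun J : Finset S => {X | J ⊆ X}) ?_ ?_ ?_ (by simp)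
  · refine le_antisymm ?_ (MeasurableSpace.generateFrom_le ?_)
    · refine fun s hs => ?_
      have : @Measurable _ _ (MeasurableSpace.generateFrom
          (Set.range fun J : Finset S => {X : Finset S | J ⊆ X})) _ (id : Finset S → Finset S) := by
        refine @measurable_finset_iff _ _ (_) _ |>.2 fun a => ?_
        refine @measurableSet_setOfPred _ (_) _ |>.1 ?_
        refine MeasurableSpace.measurableSet_generateFrom ⟨{a}, ?_⟩
        ext X; simp
      exact this hs
    · rintro _ ⟨J, rfl⟩
      exact hms J
  · rintro _ ⟨J, rfl⟩ _ ⟨J', rfl⟩ -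
    exact ⟨J ∪ J', by ext X; simp [Finset.union_subset_iff]⟩
  · rintro _ ⟨J, rfl⟩
    exact h J

/-- The determinantal point process whose kernel is the matrix of `k` in an orthonormal basis. -/
def dppMeasure {S : Type*} [Fintype S] (k : E →ₗ[𝕜] E) (e : OrthonormalBasis S 𝕜 E) :
    Measure (Finset S) :=
  ∑ X : Finset S, (weight k (Submodule.span 𝕜 (e '' X)) : ℝ≥0∞) • Measure.dirac X

open scoped Classical in
lemma IsKernel.dppMeasure_apply {k : E →ₗ[𝕜] E} (hk : IsKernel k) {S : Type*} [Fintype S]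
    (e : OrthonormalBasis S 𝕜 E) (J : Finset S) :
    dppMeasure k e {X | J ⊆ X} = correlation k (Submodule.span 𝕜 (e '' J)) := by
  rw [dppMeasure, Measure.finsetSum_apply, ← hk.sum_weight e J, ENNReal.ofNNReal_finsetSum,
    Finset.sum_filter]
  refine Finset.sum_congr rfl fun X _ => ?_
  rw [Measure.smul_apply, Measure.dirac_apply, Set.indicator_apply]
  simp

-- The weights are the point probabilities, because their sums over X ⊇ J are the required minors;
-- inclusion probabilities determine the law.
open scoped Classical in
lemma IsKernel.isDPP_iff {k : E →ₗ[𝕜] E} (hk : IsKernel k) {S : Type*} [Fintype S]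
    (e : OrthonormalBasis S 𝕜 E) (ρ : Measure (Finset S)) :
    IsDPP (LinearMap.toMatrixOrthonormal e k) ρ ↔ ρ = dppMeasure k e := by
  have hprob : IsProbabilityMeasure (dppMeasure k e) := by
    refine ⟨?_⟩
    have h := hk.dppMeasure_apply e ∅
    simp only [Finset.empty_subset, Set.ofPred_true] at h
    rw [h]
    simp [correlation, mixedDet]
  constructor
  · rintro ⟨hρ, h⟩
    refine measure_finset_ext fun J => ?_
    have h1 := h J
    rw [← mixedDet_one_span_image, ← hk.coe_correlation] at h1
    rw [hk.dppMeasure_apply, ← ofReal_measureReal, RCLike.ofReal_injective h1,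
      ENNReal.ofReal_coe_nnreal]
  · rintro rfl
    refine ⟨hprob, fun J => ?_⟩
    rw [← mixedDet_one_span_image, ← hk.coe_correlation, Measure.real, hk.dppMeasure_apply]
    rfl

lemma IsKernel.isDPP_kernelMatrix_iff {ι : Type*} [Fintype ι] {σ : Splitting 𝕜 E ι}
    {k : E →ₗ[𝕜] E} (hk : IsKernel k) (b : BlockBases σ) (ρ : Measure (Finset (Labels σ))) :
    IsDPP (kernelMatrix σ k b) ρ ↔ ρ = dppMeasure k (aggregate σ b) := by
  unfold kernelMatrix
  convert hk.isDPP_iff (aggregate σ b) ρ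

lemma IsKernel.dpp_kernelMatrix_eq {ι : Type*} [Fintype ι] {σ : Splitting 𝕜 E ι}
    {k : E →ₗ[𝕜] E} (hk : IsKernel k) (b : BlockBases σ) :
    dpp (kernelMatrix σ k b) = dppMeasure k (aggregate σ b) := by
  have h : ∃ ρ, IsDPP (kernelMatrix σ k b) ρ := ⟨_, (hk.isDPP_kernelMatrix_iff b _).2 rfl⟩
  rw [dpp, dif_pos h]
  exact (hk.isDPP_kernelMatrix_iff b _).1 h.choose_spec

end PointProcesses

/-! ### The averaging identity -/

section Averaging

variable {𝕜 E ι κ : Type*} [RCLike 𝕜] [NormedAddCommGroup E] [InnerProductSpace 𝕜 E]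
  [FiniteDimensional 𝕜 E] [Fintype ι] [Fintype κ] {σ : Splitting 𝕜 E ι} {δ : Splitting 𝕜 E κ}

omit [Fintype ι] in
lemma Splitting.stab_le_of_finer (h : δ.Finer σ) : δ.stab ≤ σ.stab := by
  intro w hw i
  refine Submodule.eq_of_le_of_finrank_eq ?_ (LinearEquiv.finrank_map_eq w.toLinearEquiv _)
  rintro _ ⟨x, hx, rfl⟩
  -- A zero block of δ lies in every block of σ; any choice serves, since it carries no basis
  -- vector.
  choose c hc using h
  let e := aggregate δ fun j => stdOrthonormalBasis 𝕜 (δ.block j)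
  have he : ∀ p, e p ∈ δ.block p.1 := aggregate_mem δ _
  have hx' := (σ.mem_block_iff e (t := fun p => c p.1) (fun p => hc _ (he p)) i x).1 hx
  rw [← e.sum_repr' x, map_sum]
  refine Submodule.sum_mem _ fun p _ => ?_
  by_cases hp : c p.1 = i
  · rw [map_smul]
    refine Submodule.smul_mem _ _ (hp ▸ hc p.1 ?_)
    exact (hw p.1).le (Submodule.mem_map_of_mem (he p))
  · rw [hx' p hp, zero_smul, map_zero]
    exact Submodule.zero_mem _

lemma dlpMeasure_apply (k : E →ₗ[𝕜] E) {A : Set (Gr σ)} (hA : MeasurableSet A) :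
    dlpMeasure σ k A = ∫⁻ Q, weight k Q.1 * A.indicator 1 Q ∂(nu σ) := by
  rw [dlpMeasure, withDensity_apply _ hA, ← lintegral_indicator hA]
  refine lintegral_congr fun Q => ?_
  by_cases hQ : Q ∈ A <;> simp [hQ]

-- The invariant measure of u(δ) is the image under u of that of δ, while the weight does not see
-- the splitting; this moves the dependence on u from the space into the integrand.
omit [Fintype ι] in
lemma map_incl_dlpMeasure_image (k : E →ₗ[𝕜] E) (h : δ.Finer σ) (u : σ.stab) {A : Set (Gr σ)}
    (hA : MeasurableSet A) :
    (dlpMeasure (δ.image u.1) k).map (Gr.incl (Splitting.image_finer h u)) A =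
      ∫⁻ R, weight k (Gr.act u (Gr.incl h R)).1 * A.indicator 1 (Gr.act u (Gr.incl h R))
        ∂(nu δ) := by
  have hi := (Gr.continuous_incl (Splitting.image_finer h u)).measurable
  have hw : ∀ j, (δ.block j).map (u.1.toLinearEquiv : E →ₗ[𝕜] E) = (δ.image u.1).block j :=
    fun _ => rfl
  rw [Measure.map_apply hi hA, dlpMeasure_apply k (hi hA), ← map_nu_transport u.1 hw,
    lintegral_map _ (Gr.continuous_transport u.1 hw).measurable]
  · rfl
  · exact (measurable_weight _ k).coe_nnreal_ennreal.mul (measurable_one.indicator (hi hA))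

/-- By Fubini, average over u first: each R adapted to δ enters only through its orbit measure under
U(E,σ), and both invariant measures are sums over subsets of one basis adapted to δ. -/
lemma dlpMeasure_eq_bind (k : E →ₗ[𝕜] E) (h : δ.Finer σ) :
    dlpMeasure σ k = (haarProb σ.stab).bind fun u =>
      (dlpMeasure (δ.image u.1) k).map (Gr.incl (Splitting.image_finer h u)) := by
  have hg : ∀ A : Set (Gr σ), MeasurableSet A →
      Measurable fun Q : Gr σ => (weight k Q.1 : ℝ≥0∞) * A.indicator 1 Q := fun A hA =>
    (measurable_weight σ k).coe_nnreal_ennreal.mul (measurable_one.indicator hA)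
  have hincl := (Gr.continuous_incl h).measurable
  have hact : Measurable fun p : σ.stab × Gr δ => Gr.act p.1 (Gr.incl h p.2) :=
    (Gr.measurable_act σ).comp (measurable_fst.prodMk (hincl.comp measurable_snd))
  have hmeas : Measurable fun u : σ.stab =>
      (dlpMeasure (δ.image u.1) k).map (Gr.incl (Splitting.image_finer h u)) := by
    refine Measure.measurable_of_measurable_coe _ fun A hA => ?_
    simp_rw [map_incl_dlpMeasure_image k h _ hA]
    exact ((hg A hA).comp hact).lintegral_prod_right'
  let e := aggregate δ fun j => stdOrthonormalBasis 𝕜 (δ.block j)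
  have he : ∀ p, ∃ j, e p ∈ δ.block j := fun p => ⟨p.1, aggregate_mem δ _ p⟩
  have he' : ∀ p, ∃ i, e p ∈ σ.block i := fun p => by
    obtain ⟨i, hi⟩ := h p.1
    exact ⟨i, hi (aggregate_mem δ _ p)⟩
  ext A hA
  rw [Measure.bind_apply hA hmeas.aemeasurable]
  simp_rw [map_incl_dlpMeasure_image k h _ hA]
  have hjoint : Measurable (Function.uncurry fun (u : σ.stab) (R : Gr δ) =>
      (weight k (Gr.act u (Gr.incl h R)).1 : ℝ≥0∞) * A.indicator 1 (Gr.act u (Gr.incl h R))) :=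
    (hg A hA).comp hact
  rw [dlpMeasure_apply k hA, lintegral_nu e he' (hg A hA),
    lintegral_lintegral_swap hjoint.aemeasurable]
  have horb : ∀ Q : Gr σ, ∫⁻ u : σ.stab, weight k (Gr.act u Q).1 * A.indicator 1 (Gr.act u Q)
      ∂(haarProb σ.stab) = ∫⁻ R, weight k R.1 * A.indicator 1 R ∂Q.orbitMeasure := fun Q =>
    (lintegral_map (hg A hA) (Gr.measurable_act_left Q)).symm
  simp_rw [horb]
  rw [lintegral_nu e he]
  · refine Finset.sum_congr rfl fun X _ => ?_
    -- The rotation w coming from the invariant measure of δ lies in U(E,σ), so it does not change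
    -- the orbit measure.
    have hw : ∀ w : δ.stab, (Gr.incl h (Gr.act w (spanGr δ e he X))).orbitMeasure =
        (spanGr σ e he' X).orbitMeasure := fun w =>
      Gr.orbitMeasure_act ⟨w.1, Splitting.stab_le_of_finer h w.2⟩ (spanGr σ e he' X)
    simp [hw]
  · simp_rw [← horb]
    exact hjoint.lintegral_prod_left'

end Averaging

/-! ### Sampling -/

section Sampling

variable {𝕜 E ι : Type*} [RCLike 𝕜] [NormedAddCommGroup E] [InnerProductSpace 𝕜 E]
  [FiniteDimensional 𝕜 E]

/-- The restriction of an element of the stabiliser of a splitting to a block. -/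
def Splitting.restrictBlock (σ : Splitting 𝕜 E ι) (i : ι) (u : σ.stab) :
    σ.block i ≃ₗᵢ[𝕜] σ.block i :=
  LinearIsometry.toLinearIsometryEquiv
    ⟨(u.1.toLinearEquiv : E →ₗ[𝕜] E).restrict
      fun _ hx => (u.2 i).le (Submodule.mem_map_of_mem hx), fun x => u.1.norm_map x⟩ rfl

/-- The restrictions of an element of the stabiliser of a splitting to the blocks. -/
def Splitting.restrictBlocks (σ : Splitting 𝕜 E ι) :
    σ.stab →* ∀ i, σ.block i ≃ₗᵢ[𝕜] σ.block i where
  toFun u i := σ.restrictBlock i u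
  map_one' := funext fun _ => LinearIsometryEquiv.ext fun _ => rfl
  map_mul' _ _ := funext fun _ => LinearIsometryEquiv.ext fun _ => rfl

lemma Splitting.continuous_restrictBlocks (σ : Splitting 𝕜 E ι) :
    Continuous σ.restrictBlocks := by
  refine continuous_pi fun i => isInducing_isoToEnd.continuous_iff.2 ?_
  have h : (isoToEnd ∘ fun u : σ.stab => σ.restrictBlocks u i) = fun u =>
      (σ.block i).orthogonalProjectionOnto ∘L isoToEnd u.1 ∘L (σ.block i).subtypeL := by
    ext1 u
    ext1 x
    exact (Submodule.orthogonalProjectionOnto_mem_subspace_eq_self (σ.restrictBlock i u x)).symm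
  rw [h]
  exact continuous_const.clm_comp
    ((continuous_isoToEnd.comp continuous_subtype_val).clm_comp continuous_const)

variable [Fintype ι]

lemma Splitting.restrictBlocks_surjective (σ : Splitting 𝕜 E ι) :
    Function.Surjective σ.restrictBlocks := by
  intro v
  let b : BlockBases σ := fun i => stdOrthonormalBasis 𝕜 (σ.block i)
  let e := aggregate σ b
  let e' := aggregate σ fun i => (b i).map (v i)
  let u := e.equiv e' (Equiv.refl _)
  have hu : ∀ i (x : σ.block i), u x = v i x := by
    intro i
    have : (u.toLinearEquiv : E →ₗ[𝕜] E) ∘ₗ (σ.block i).subtype =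
        (σ.block i).subtype ∘ₗ ((v i).toLinearEquiv : σ.block i →ₗ[𝕜] σ.block i) := by
      refine (b i).toBasis.ext fun j => ?_
      rw [(b i).coe_toBasis]
      change u (b i j : E) = v i (b i j)
      have h1 : e ⟨i, j⟩ = (b i j : E) := aggregate_apply σ b ⟨i, j⟩
      have h2 : e' ⟨i, j⟩ = (v i (b i j) : E) := aggregate_apply σ _ ⟨i, j⟩
      rw [← h1, ← h2]
      exact e.equiv_apply_basis e' (Equiv.refl _) ⟨i, j⟩
    exact fun x => LinearMap.congr_fun this x
  refine ⟨⟨u, fun i => ?_⟩, funext fun i => LinearIsometryEquiv.ext fun x => Subtype.ext (hu i x)⟩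
  refine Submodule.eq_of_le_of_finrank_eq ?_ (LinearEquiv.finrank_map_eq u.toLinearEquiv _)
  rintro _ ⟨x, hx, rfl⟩
  exact (hu i ⟨x, hx⟩).symm ▸ Subtype.coe_prop _

/-- Restriction to the blocks maps U(E,σ) onto the product of their isometry groups, whose Haar
probability is the product measure: the restrictions are independent and uniform. -/
lemma map_haarProb_restrictBlocks (σ : Splitting 𝕜 E ι) :
    (haarProb σ.stab).map σ.restrictBlocks =
      Measure.pi fun i => haarProb (σ.block i ≃ₗᵢ[𝕜] σ.block i) := by
  rw [map_haarProb_of_surjective _ σ.continuous_restrictBlocks σ.restrictBlocks_surjective]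
  exact Measure.isHaarMeasure_eq_of_isProbabilityMeasure _ _

omit [Fintype ι] [FiniteDimensional 𝕜 E] in
lemma continuous_onb_apply {S : Type*} [Fintype S] (p : S) :
    Continuous fun b : OrthonormalBasis S 𝕜 E => b p :=
  (continuous_apply p).comp continuous_induced_dom

omit [Fintype ι] [FiniteDimensional 𝕜 E] in
lemma continuous_onb_map {S : Type*} [Fintype S] (b : OrthonormalBasis S 𝕜 E) :
    Continuous fun u : E ≃ₗᵢ[𝕜] E => b.map u :=
  continuous_induced_rng.2 (continuous_pi fun p => by
    have h : Continuous fun u : E ≃ₗᵢ[𝕜] E => isoToEnd u (b p) :=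
      continuous_isoToEnd.clm_apply continuous_const
    simpa only [Function.comp_apply, b.map_apply, isoToEnd_apply] using h)

/-- The family of bases of the blocks obtained from a reference family by applying an element of
the stabiliser. -/
def rotatedBases (σ : Splitting 𝕜 E ι) (u : σ.stab) : BlockBases σ := fun i =>
  (stdOrthonormalBasis 𝕜 (σ.block i)).map (σ.restrictBlock i u)

omit [Fintype ι] in
lemma measurable_rotatedBases (σ : Splitting 𝕜 E ι) : Measurable (rotatedBases σ) :=
  measurable_pi_iff.2 fun i => ((continuous_onb_map (stdOrthonormalBasis 𝕜 (σ.block i))).comp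
    ((continuous_apply i).comp σ.continuous_restrictBlocks)).measurable

lemma map_haarProb_rotatedBases (σ : Splitting 𝕜 E ι) :
    (haarProb σ.stab).map (rotatedBases σ) = Measure.pi fun i => uniformONB 𝕜 (σ.block i) := by
  have hm : ∀ i, Measurable fun u : σ.block i ≃ₗᵢ[𝕜] σ.block i =>
      (stdOrthonormalBasis 𝕜 (σ.block i)).map u := fun i => (continuous_onb_map _).measurable
  have hp : ∀ i, IsProbabilityMeasure ((haarProb (σ.block i ≃ₗᵢ[𝕜] σ.block i)).map
      fun u => (stdOrthonormalBasis 𝕜 (σ.block i)).map u) := fun i =>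
    Measure.isProbabilityMeasure_map (hm i).aemeasurable
  unfold uniformONB
  have hpi : Measurable fun (v : ∀ i, σ.block i ≃ₗᵢ[𝕜] σ.block i) i =>
      (stdOrthonormalBasis 𝕜 (σ.block i)).map (v i) :=
    measurable_pi_iff.2 fun i => (hm i).comp (measurable_pi_apply i)
  rw [← Measure.pi_map_pi fun i => (hm i).aemeasurable, ← map_haarProb_restrictBlocks,
    Measure.map_map hpi σ.continuous_restrictBlocks.measurable]
  rfl

/-- Makes the projection on the selected span visibly continuous in the basis vectors, for
`measurable_selectedSpan`. -/
lemma starProjection_span_image_eq_sum {S : Type*} [Fintype S] (e : OrthonormalBasis S 𝕜 E)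
    (X : Finset S) : (Submodule.span 𝕜 (e '' X)).starProjection =
      ∑ p ∈ X, InnerProductSpace.rankOne 𝕜 (e p) (e p) := by
  classical
  refine ContinuousLinearMap.coe_injective (e.toBasis.ext fun q => ?_)
  rw [e.coe_toBasis, ContinuousLinearMap.coe_coe, starProjection_span_image]
  simp [e.inner_eq_ite]

lemma measurable_selectedSpan (σ : Splitting 𝕜 E ι) (X : Finset (Labels σ)) :
    Measurable fun b : BlockBases σ => selectedSpan σ b X := by
  have : ProperSpace (E →L[𝕜] E) := FiniteDimensional.proper 𝕜 _
  refine Gr.measurable_iff_proj.2 ?_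
  have h : (fun b : BlockBases σ => (selectedSpan σ b X).proj) = fun b =>
      ∑ p ∈ X, InnerProductSpace.rankOne 𝕜 (b p.1 p.2 : E) (b p.1 p.2 : E) := by
    ext1 b
    refine (starProjection_span_image_eq_sum (aggregate σ b) X).trans ?_
    simp only [aggregate_apply]
  rw [h]
  refine Finset.measurable_sum _ fun p _ => ?_
  have hc : Continuous fun b : OrthonormalBasis (Fin (finrank 𝕜 (σ.block p.1))) 𝕜 (σ.block p.1) =>
      InnerProductSpace.rankOne 𝕜 (b p.2 : E) (b p.2 : E) := by
    have h1 : Continuous fun b : OrthonormalBasis (Fin (finrank 𝕜 (σ.block p.1))) 𝕜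
        (σ.block p.1) => (b p.2 : E) := continuous_subtype_val.comp (continuous_onb_apply p.2)
    exact (ContinuousLinearMap.smulRightL 𝕜 E E).continuous₂.comp
      (((innerSL 𝕜).continuous.comp h1).prodMk h1)
  exact hc.measurable.comp (measurable_pi_apply p.1)

lemma IsKernel.map_selectedSpan_apply {σ : Splitting 𝕜 E ι} {k : E →ₗ[𝕜] E} (hk : IsKernel k)
    (b : BlockBases σ) {A : Set (Gr σ)} (hA : MeasurableSet A) :
    (dpp (kernelMatrix σ k b)).map (selectedSpan σ b) A = ∑ X : Finset (Labels σ),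
      (weight k (selectedSpan σ b X).1 : ℝ≥0∞) * A.indicator 1 (selectedSpan σ b X) := by
  rw [hk.dpp_kernelMatrix_eq, Measure.map_apply .of_discrete hA, dppMeasure,
    Measure.finsetSum_apply]
  refine Finset.sum_congr rfl fun X _ => ?_
  rw [Measure.smul_apply, Measure.dirac_apply, smul_eq_mul]
  rfl

lemma IsKernel.samplingLaw_eq {σ : Splitting 𝕜 E ι} {k : E →ₗ[𝕜] E} (hk : IsKernel k) :
    samplingLaw σ k = dlpMeasure σ k := by
  have hg : ∀ A : Set (Gr σ), MeasurableSet A →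
      Measurable fun Q : Gr σ => (weight k Q.1 : ℝ≥0∞) * A.indicator 1 Q := fun A hA =>
    (measurable_weight σ k).coe_nnreal_ennreal.mul (measurable_one.indicator hA)
  have hsum : ∀ A : Set (Gr σ), MeasurableSet A → Measurable fun b : BlockBases σ =>
      ∑ X : Finset (Labels σ),
        (weight k (selectedSpan σ b X).1 : ℝ≥0∞) * A.indicator 1 (selectedSpan σ b X) :=
    fun A hA => Finset.measurable_sum _ fun X _ => (hg A hA).comp (measurable_selectedSpan σ X)
  have hmeas : Measurable fun b : BlockBases σ =>
      (dpp (kernelMatrix σ k b)).map (selectedSpan σ b) := by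
    refine Measure.measurable_of_measurable_coe _ fun A hA => ?_
    simp_rw [hk.map_selectedSpan_apply _ hA]
    exact hsum A hA
  let e := aggregate σ fun i => stdOrthonormalBasis 𝕜 (σ.block i)
  have he : ∀ p, ∃ i, e p ∈ σ.block i := fun p => ⟨p.1, aggregate_mem σ _ p⟩
  -- The random bases of the blocks aggregate to u(e) for a single uniform u, which turns the
  -- sampling law into the sum over subsets representing the integral against ν.
  have hrot : ∀ u X, selectedSpan σ (rotatedBases σ u) X = Gr.act u (spanGr σ e he X) := by
    intro u X
    refine Gr.ext ?_
    rw [act_spanGr_toSubmodule]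
    change Submodule.span 𝕜 (aggregate σ (rotatedBases σ u) '' X) = _
    congr 2
    ext1 p
    rw [e.map_apply, aggregate_apply, aggregate_apply]
    rfl
  ext A hA
  rw [samplingLaw, Measure.bind_apply hA hmeas.aemeasurable, ← map_haarProb_rotatedBases]
  simp_rw [hk.map_selectedSpan_apply _ hA]
  rw [lintegral_map (hsum A hA) (measurable_rotatedBases σ), dlpMeasure_apply k hA,
    lintegral_nu e he (hg A hA)]
  simp_rw [hrot]
  exact lintegral_finsetSum _ fun X _ => (hg A hA).comp (Gr.measurable_act_left _)

end Sampling

end DLP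

end

theorem mainTheorem4 {𝕜 E ι : Type*} [RCLike 𝕜] [NormedAddCommGroup E] [InnerProductSpace 𝕜 E]
    [FiniteDimensional 𝕜 E] [Fintype ι] (σ : DLP.Splitting 𝕜 E ι)
    (k : E →ₗ[𝕜] E) (hk : DLP.IsKernel k) :
    -- `μ_{σ,k}` is well defined: it is the unique determinantal linear process with kernel `k`
    (∀ μ : Measure (DLP.Gr σ), DLP.IsDLP σ k μ ↔ μ = DLP.dlp σ k) ∧
    -- the determinantal point process with kernel the matrix of `k` in a basis is well defined
    (∀ (b : DLP.BlockBases σ) (ρ : Measure (Finset (DLP.Labels σ))),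
      DLP.IsDPP (DLP.kernelMatrix σ k b) ρ ↔ ρ = DLP.dpp (DLP.kernelMatrix σ k b)) ∧
    -- the sampling procedure produces a random subspace distributed according to `μ_{σ,k}`
    DLP.samplingLaw σ k = DLP.dlp σ k ∧
    -- the averaging identity, for every splitting `δ` finer than `σ`
    ∀ {κ : Type*} [Fintype κ] (δ : DLP.Splitting 𝕜 E κ) (h : δ.Finer σ),
      DLP.dlp σ k = (DLP.haarProb σ.stab).bind fun u =>
        (DLP.dlp (δ.image u) k).map (DLP.Gr.incl (DLP.Splitting.image_finer h u)) := by
  refine ⟨fun μ => ?_, fun b ρ => ?_, ?_, fun δ h => ?_⟩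
  · rw [hk.dlp_eq]
    exact hk.isDLP_iff μ
  · rw [hk.dpp_kernelMatrix_eq]
    exact hk.isDPP_kernelMatrix_iff b ρ
  · rw [hk.dlp_eq]
    exact hk.samplingLaw_eq
  · simp_rw [hk.dlp_eq]
    exact DLP.dlpMeasure_eq_bind k h
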